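/- Let $W\in\mathbb{C}[x_1,\dots,x_n]$ be a weighted homogeneous polynomial of weight $(w_1,\dots,w_n;h)$, where $w_i,h$ are positive integers with $\gcd(w_1,\dots,w_n,h)=1$. Assume that $W$ is non-degenerate: it contains no monomial $x_ix_j$ with $i\ne j$, and it has an isolated singularity at the origin. Let $G_W=\{g\in(\mathbb{C}^*)^n : W(g_1x_1,\dots,g_nx_n)=W(x_1,\dots,x_n)\}$. For $g\in G_W$ let $\theta_{g,i}\in[0,1)$ be defined by $g_i=e^{2\pi i\theta_{g,i}}$ (the group $G_W$ is finite, so $|g_i|=1$), and let $\theta_{J,i}=w_i/h$. Let $\mathcal R_t=\mathrm{diag}(e^{2\pi i t\theta_{J,1}},\dots,e^{2\pi i t\theta_{J,n}})$; this is the Reeb flow on the link $L_{W,\delta}=W^{-1}(0)\cap\{\sum_k|z_k|^2=\delta^2\}$, $\delta>0$, for the contact form $\frac{h}{\delta^2}\lambda$, where $\lambda=\sum_k\frac{i}{4\pi w_k}(z_kd\bar z_k-\bar z_kdz_k)$. For $l>0$ put $(\mathbb{C}^n)^{g,l}=\{x: g\mathcal R_l(x)=x\}$, $\Sigma_{g,l}=(\mathbb{C}^n)^{g,l}\cap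 L_{W,\delta}$ (the $g$-twisted Reeb orbits of period $l$, a point $p$ standing for $\gamma(t)=\mathcal R_tp$, $0\le t\le l$, with $g\gamma(l)=\gamma(0)$), and $$I=I_{g,l}=\{i:\ \partial_iW|_{(\mathbb{C}^n)^{g,l}}=0\},\qquad I^c=\{1,\dots,n\}\setminus I.$$ Let $p\in\Sigma_{g,l}$. The Robbin–Salamon index of the linearized Reeb flow along $\gamma$ is defined as follows. Along $\gamma$ the tangent bundle of the Milnor fiber is $\ker dW$, with its complex structure and the symplectic form $d\lambda$. Choose a $C^1$ unitary frame $F(t)$ of $\ker dW_{\gamma(t)}$, $t\in[0,l]$, with $gF(l)=F(0)$, such that the linearized flow $\mathcal R_t:\ker dW_p\to\ker dW_{\gamma(t)}$, written in $F$, is a path $A:[0,l]\to U(n-1)\subset Sp(2n-2)$ all of whose crossings (times with $\ker(A(t)-1)\neq0$) are regular. Its Robbin–Salamon index $\mu(A)$ is the sum over all crossings of the signatures of the crossing forms $v\mapsto\omega_0(v,A'(t)v)$ on $\ker(A(t)-1)$, where the crossings at $t=0$ and $t=l$ are counted with the factor $\frac12$. Let $\mathrm{rot}_\Omega(F)\in\mathbb{R}$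 be the rotation number of $F$ with respect to the residue form $\Omega=(dz_1\wedge\dots\wedge dz_n)/dW$, i.e. the total change of $\frac1{2\pi}\arg\Omega(F(t))$ over $[0,l]$. The index is $\mu(A)+2\,\mathrm{rot}_\Omega(F)$. Then such frames $F$ exist, the index is the same number for all of them, and it is given for every $p\in\Sigma_{g,l}$ by $$\mu_{\mathrm{RS}}(\Sigma_{g,l})=2\Big(-\sum_{i\in I}\theta_{g,i}+\sum_{j\in I^c}(l\theta_{J,j}-l)\Big)+\sum_{i\in I}Q(l\theta_{J,i}+\theta_{g,i})+(|I^c|-1)\,Q(l),$$ where $Q(s)=2s$ if $s\in\mathbb{Z}$ and $Q(s)=2\lfloor s\rfloor+1$ otherwise. -/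

import Mathlib

noncomputable section

/-! ## Signature, crossing forms and the Robbin–Salamon index of a symplectic path -/

namespace RobbinSalamon

/-- The standard symplectic form `ω₀(u, v) = Im ⟪u, v⟫ = ∑ₖ Im (ūₖ vₖ) = ∑ₖ dxₖ ∧ dyₖ (u, v)` on
`ℂᵐ = ℝ²ᵐ`, as a real bilinear form. -/
def omega (m : ℕ) : LinearMap.BilinForm ℝ (EuclideanSpace ℂ (Fin m)) :=
  LinearMap.mk₂ ℝ (fun u v => (inner ℂ u v).im)
    (fun u u' v => by simp)
    (fun c u v => by simp [inner_smul_left_eq_smul])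
    (fun u v v' => by simp)
    (fun c u v => by simp [inner_smul_right_eq_smul])

/-- A real endomorphism of `ℂᵐ = ℝ²ᵐ` is symplectic if it preserves `ω₀`. -/
def IsSymplectic {m : ℕ} (A : EuclideanSpace ℂ (Fin m) →L[ℝ] EuclideanSpace ℂ (Fin m)) : Prop :=
  ∀ u v, omega m (A u) (A v) = omega m u v

/-- The crossing form of a path `Ψ : [a, b] → Sp(2m)` at the time `t`: the quadratic form
`v ↦ ω₀(v, Ψ'(t) v)` on the real vector space `ker (Ψ(t) - 1)`.  (If `Ψ' = J₀ S Ψ` with `S`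
symmetric and `J₀` the multiplication by `i`, this is `v ↦ ⟨v, S(t) v⟩`.) -/
def crossingForm {m : ℕ} (Ψ : ℝ → EuclideanSpace ℂ (Fin m) →L[ℝ] EuclideanSpace ℂ (Fin m))
    (a b t : ℝ) : QuadraticForm ℝ (LinearMap.ker (Ψ t - 1).toLinearMap) :=
  (LinearMap.BilinMap.toQuadraticMap
    ((omega m).compl₂ (derivWithin Ψ (Set.Icc a b) t).toLinearMap)).restrict _

/-- The signature of the crossing form at the time `t` (zero if `t` is not a crossing, i.e. if
`ker (Ψ(t) - 1) = 0`). -/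
def crossingSignature {m : ℕ}
    (Ψ : ℝ → EuclideanSpace ℂ (Fin m) →L[ℝ] EuclideanSpace ℂ (Fin m)) (a b t : ℝ) : ℝ :=
  (sigPos (crossingForm Ψ a b t) : ℝ) - (sigNeg (crossingForm Ψ a b t) : ℝ)

/-- A `C¹` path `Ψ : [a, b] → Sp(2m)` all of whose crossings are regular, i.e. have a nondegenerate
crossing form.  Regular crossings are isolated, so there are finitely many of them. -/
structure IsRegularPath {m : ℕ}
    (Ψ : ℝ → EuclideanSpace ℂ (Fin m) →L[ℝ] EuclideanSpace ℂ (Fin m)) (a b : ℝ) : Prop where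
  contDiffOn : ContDiffOn ℝ 1 Ψ (Set.Icc a b)
  symplectic : ∀ t ∈ Set.Icc a b, IsSymplectic (Ψ t)
  regular : ∀ t ∈ Set.Icc a b, (crossingForm Ψ a b t).radical = ⊥

/-- The Robbin–Salamon index of a path with regular crossings: the sum of the signatures of the
crossing forms over all crossings, where the two ends of the interval count one half. -/
def index {m : ℕ} (Ψ : ℝ → EuclideanSpace ℂ (Fin m) →L[ℝ] EuclideanSpace ℂ (Fin m))
    (a b : ℝ) : ℝ :=
  crossingSignature Ψ a b a / 2 + (∑ᶠ t ∈ Set.Ioo a b, crossingSignature Ψ a b t)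
    + crossingSignature Ψ a b b / 2

/-- `ρ` is the rotation number of the nowhere vanishing path `c : [a, b] → ℂ`, i.e. the total change
of a continuous choice of `arg c / 2π`. -/
def IsRotationNumber (c : ℝ → ℂ) (a b ρ : ℝ) : Prop :=
  ∃ φ : ℝ → ℝ, ContinuousOn φ (Set.Icc a b) ∧
    (∀ t ∈ Set.Icc a b, c t ≠ 0 ∧ c t = ‖c t‖ * Complex.exp (2 * Real.pi * Complex.I * φ t)) ∧
    φ b - φ a = ρ

/-- `Q(s) = 2s` if `s` is an integer, and `Q(s) = 2⌊s⌋ + 1` otherwise. -/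
def Q (s : ℝ) : ℝ :=
  open Classical in if ∃ k : ℤ, (k : ℝ) = s then 2 * s else 2 * (⌊s⌋ : ℝ) + 1

end RobbinSalamon

/-! ## Weighted homogeneous polynomials, diagonal symmetries and twisted Reeb orbits -/

namespace LGOrbifold

/-- `W` is weighted homogeneous of weight `(w₁, …, wₙ; h)`. -/
structure HasWeight {n : ℕ} (W : MvPolynomial (Fin n) ℂ) (w : Fin n → ℕ) (h : ℕ) : Prop where
  weight_pos : ∀ i, 0 < w i
  degree_pos : 0 < h
  gcd_eq_one : (Finset.univ.gcd w).gcd h = 1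
  homogeneous : MvPolynomial.IsWeightedHomogeneous w W h

/-- The partial derivative `∂ᵢW (x)`. -/
def partialAt {n : ℕ} (W : MvPolynomial (Fin n) ℂ) (i : Fin n) (x : Fin n → ℂ) : ℂ :=
  MvPolynomial.eval x (MvPolynomial.pderiv i W)

/-- `W` is non-degenerate: it contains no monomial `xᵢ xⱼ` with `i ≠ j`, and it has an isolated
singularity at the origin. -/
structure IsNondegenerate {n : ℕ} (W : MvPolynomial (Fin n) ℂ) : Prop where
  no_cross_term : ∀ i j : Fin n, i ≠ j →
    MvPolynomial.coeff (Finsupp.single i 1 + Finsupp.single j 1) W = 0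
  singular : ∀ i, partialAt W i 0 = 0
  isolated : ∀ᶠ x in nhdsWithin (0 : Fin n → ℂ) {0}ᶜ, ∃ i, partialAt W i x ≠ 0

/-- The maximal diagonal symmetry group
`G_W = {g ∈ (ℂˣ)ⁿ : W (g₁x₁, …, gₙxₙ) = W (x₁, …, xₙ)}`. -/
def symmetryGroup {n : ℕ} (W : MvPolynomial (Fin n) ℂ) : Subgroup (Fin n → ℂˣ) where
  carrier := {g | ∀ x : Fin n → ℂ,
    MvPolynomial.eval (fun i => (g i : ℂ) * x i) W = MvPolynomial.eval x W}
  mul_mem' := by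
    intro a b ha hb x
    have h1 := ha (fun i => (b i : ℂ) * x i)
    rw [hb x] at h1
    rw [← h1]
    simp [mul_assoc]
  one_mem' := by intro x; simp
  inv_mem' := by
    intro a ha x
    have h1 := ha (fun i => ((a i)⁻¹ : ℂ) * x i)
    simpa using h1.symm

/-- The diagonal action of `g ∈ (ℂˣ)ⁿ` on `ℂⁿ`. -/
def act {n : ℕ} (g : Fin n → ℂˣ) (x : Fin n → ℂ) : Fin n → ℂ := fun i => (g i : ℂ) * x i

/-- `θ_{g,i} ∈ [0, 1)` with `gᵢ = exp (2πi θ_{g,i})` (for `|gᵢ| = 1`). -/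
def theta {n : ℕ} (g : Fin n → ℂˣ) (i : Fin n) : ℝ :=
  Int.fract (Complex.arg (g i : ℂ) / (2 * Real.pi))

/-- `θ_{J,i} = wᵢ / h`. -/
def thetaJ {n : ℕ} (w : Fin n → ℕ) (h : ℕ) (i : Fin n) : ℝ := (w i : ℝ) / (h : ℝ)

/-- The Reeb flow `R_t = exp (2πi t θ_J)`.  It is linear on `ℂⁿ`, so it is also its own
linearization. -/
def reebFlow {n : ℕ} (w : Fin n → ℕ) (h : ℕ) (t : ℝ) (x : Fin n → ℂ) : Fin n → ℂ :=
  fun i => Complex.exp (2 * Real.pi * Complex.I * ((t * thetaJ w h i : ℝ) : ℂ)) * x i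

/-- The link `L_{W,δ} = W⁻¹(0) ∩ S_δ`. -/
def link {n : ℕ} (W : MvPolynomial (Fin n) ℂ) (δ : ℝ) : Set (Fin n → ℂ) :=
  {x | MvPolynomial.eval x W = 0 ∧ ∑ i, ‖x i‖ ^ 2 = δ ^ 2}

/-- `(ℂⁿ)^{g,l}`, the fixed locus of `g ∘ R_l`. -/
def fixedLocus {n : ℕ} (w : Fin n → ℕ) (h : ℕ) (g : Fin n → ℂˣ) (l : ℝ) : Set (Fin n → ℂ) :=
  {x | act g (reebFlow w h l x) = x}

/-- `Σ_{g,l}`, the space of `g`-twisted Reeb orbits of period `l` in the link; a point `p` stands for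
the orbit `γ(t) = R_t p`, `t ∈ [0, l]`, which satisfies `g γ(l) = γ(0)`. -/
def twistedOrbits {n : ℕ} (W : MvPolynomial (Fin n) ℂ) (w : Fin n → ℕ) (h : ℕ) (δ : ℝ)
    (g : Fin n → ℂˣ) (l : ℝ) : Set (Fin n → ℂ) :=
  fixedLocus w h g l ∩ link W δ

/-- `I_{g,l}`, the set of the indices `i` such that `∂ᵢW` vanishes identically on `(ℂⁿ)^{g,l}`. -/
def indexSet {n : ℕ} (W : MvPolynomial (Fin n) ℂ) (w : Fin n → ℕ) (h : ℕ) (g : Fin n → ℂˣ)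
    (l : ℝ) : Finset (Fin n) :=
  open Classical in Finset.univ.filter fun i => ∀ x ∈ fixedLocus w h g l, partialAt W i x = 0

/-- The Hermitian form `∑ₖ ūₖ vₖ / (π wₖ)`.  Its imaginary part is the symplectic form
`dλ = ∑ₖ (i / 2π wₖ) dzₖ ∧ dz̄ₖ`. -/
def herm {n : ℕ} (w : Fin n → ℕ) (u v : Fin n → ℂ) : ℂ :=
  ∑ k, (starRingEnd ℂ) (u k) * v k / (Real.pi * (w k : ℂ))

/-- The value at `v` of the Liouville form `λ = ∑ₖ (i / 4π wₖ) (zₖ dz̄ₖ - z̄ₖ dzₖ)` at the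
point `x`. -/
def liouville {n : ℕ} (w : Fin n → ℕ) (x v : Fin n → ℂ) : ℂ :=
  ∑ k, Complex.I / (4 * Real.pi * (w k : ℂ)) *
    (x k * (starRingEnd ℂ) (v k) - (starRingEnd ℂ) (x k) * v k)

/-- The vector field that generates `R_t`. -/
def reebField {n : ℕ} (w : Fin n → ℕ) (h : ℕ) (x : Fin n → ℂ) : Fin n → ℂ :=
  fun k => 2 * Real.pi * Complex.I * (thetaJ w h k : ℂ) * x k

/-- `R_t` is the flow of `reebField`. -/
theorem hasDerivAt_reebFlow {n : ℕ} (w : Fin n → ℕ) (h : ℕ) (x : Fin n → ℂ) (t : ℝ) :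
    HasDerivAt (fun s => reebFlow w h s x) (reebField w h (reebFlow w h t x)) t := by
  rw [hasDerivAt_pi]
  intro k
  have h1 : HasDerivAt (fun s : ℝ => 2 * Real.pi * Complex.I * ((s * thetaJ w h k : ℝ) : ℂ))
      (2 * Real.pi * Complex.I * (thetaJ w h k : ℂ)) t := by
    have := ((hasDerivAt_id t).mul_const (thetaJ w h k)).ofReal_comp.const_mul
      (2 * Real.pi * Complex.I)
    simpa using this
  have h2 := (h1.cexp).mul_const (x k)
  refine h2.congr_deriv ?_
  simp only [reebFlow, reebField]
  ring

/-- On the sphere of radius `δ` the form `(h / δ²) λ` takes the value `1` on `reebField`. -/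
theorem liouville_reebField {n : ℕ} (w : Fin n → ℕ) (h : ℕ) (hw : ∀ i, 0 < w i) (hh : 0 < h)
    (x : Fin n → ℂ) :
    liouville w x (reebField w h x) = ((∑ k, ‖x k‖ ^ 2 : ℝ) : ℂ) / (h : ℂ) := by
  simp only [liouville, reebField, thetaJ]
  push_cast
  rw [Finset.sum_div]
  refine Finset.sum_congr rfl fun k _ => ?_
  have h1 : (w k : ℂ) ≠ 0 := by exact_mod_cast (hw k).ne'
  have h2 : (h : ℂ) ≠ 0 := by exact_mod_cast hh.ne'
  have h3 : (Real.pi : ℂ) ≠ 0 := by exact_mod_cast Real.pi_ne_zero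
  have h4 : (starRingEnd ℂ) (x k) * x k = (‖x k‖ : ℂ) ^ 2 := Complex.conj_mul' (x k)
  simp only [map_mul, map_div₀, map_natCast, Complex.conj_I, Complex.conj_ofReal, map_ofNat]
  rw [← h4]
  field_simp
  rw [Complex.I_sq]
  ring

/-- `dλ (reebField, v) = 0` for `v` tangent to the sphere.  So `R_t` is the Reeb flow of the contact
form `(h / δ²) λ` on the link. -/
theorem herm_reebField {n : ℕ} (w : Fin n → ℕ) (h : ℕ) (hw : ∀ i, 0 < w i)
    (x v : Fin n → ℂ) (hv : ∑ k, ((starRingEnd ℂ) (x k) * v k).re = 0) :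
    (herm w (reebField w h x) v).im = 0 := by
  have h0 : herm w (reebField w h x) v
      = ((-2 / (h : ℝ) : ℝ) : ℂ) * Complex.I * ∑ k, (starRingEnd ℂ) (x k) * v k := by
    simp only [herm, reebField, thetaJ]
    rw [Finset.mul_sum]
    refine Finset.sum_congr rfl fun k _ => ?_
    have h1 : (w k : ℂ) ≠ 0 := by exact_mod_cast (hw k).ne'
    have h3 : (Real.pi : ℂ) ≠ 0 := by exact_mod_cast Real.pi_ne_zero
    simp only [map_mul, Complex.conj_I, Complex.conj_ofReal, map_ofNat]
    push_cast
    field_simp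
  rw [h0, mul_assoc, Complex.im_ofReal_mul, Complex.I_mul_im, Complex.re_sum, hv, mul_zero]

/-- `ker dW_x`.  Along the link this is the tangent space of `W⁻¹(0)`, which is the tangent space of
the Milnor fiber `{W = ψ(|x|²)}` there, as the cutoff function `ψ` vanishes near the boundary. -/
def tangentSpace {n : ℕ} (W : MvPolynomial (Fin n) ℂ) (x : Fin n → ℂ) : Submodule ℂ (Fin n → ℂ) :=
  LinearMap.ker (∑ i, partialAt W i x • (LinearMap.proj i : (Fin n → ℂ) →ₗ[ℂ] ℂ))

/-- The residue form `Ω = (dz₁ ∧ ⋯ ∧ dzₙ) / dW` on `ker dW_x`, evaluated at `n - 1` vectors: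
`Ω (v₁, …, vₙ₋₁) = det (ν, v₁, …, vₙ₋₁) / dW_x ν`, with `ν` the conjugate of the gradient of `W`. -/
def residueForm {m : ℕ} (W : MvPolynomial (Fin (m + 1)) ℂ) (x : Fin (m + 1) → ℂ)
    (v : Fin m → Fin (m + 1) → ℂ) : ℂ :=
  Matrix.det (Matrix.of (Fin.cons (fun i => (starRingEnd ℂ) (partialAt W i x)) v)) /
    ∑ i, partialAt W i x * (starRingEnd ℂ) (partialAt W i x)

/-- `residueForm` does not depend on the choice of the normal vector: `dW ∧ Ω = dz₁ ∧ ⋯ ∧ dzₙ`. -/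
theorem mul_residueForm {m : ℕ} (W : MvPolynomial (Fin (m + 1)) ℂ) (x ν : Fin (m + 1) → ℂ)
    (v : Fin m → Fin (m + 1) → ℂ) (hx : ∃ i, partialAt W i x ≠ 0)
    (hv : ∀ j, ∑ i, partialAt W i x * v j i = 0) :
    (∑ i, partialAt W i x * ν i) * residueForm W x v = Matrix.det (Matrix.of (Fin.cons ν v)) := by
  set n : Fin (m + 1) → ℂ := fun i => (starRingEnd ℂ) (partialAt W i x) with hn
  set D : (Fin (m + 1) → ℂ) → ℂ := fun u => Matrix.det (Matrix.of (Fin.cons u v)) with hD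
  have hupd : ∀ u, D u = Matrix.det ((Matrix.of (Fin.cons n v)).updateRow 0 u) := by
    intro u
    simp only [hD]
    congr 1
    ext i j
    refine Fin.cases ?_ (fun i => ?_) i
    · simp
    · rw [Matrix.updateRow_ne (Fin.succ_ne_zero i)]; simp
  have hc : ∑ i, partialAt W i x * n i ≠ 0 := by
    have h1 : ∑ i, partialAt W i x * n i = ((∑ i, ‖partialAt W i x‖ ^ 2 : ℝ) : ℂ) := by
      push_cast
      exact Finset.sum_congr rfl fun i _ => Complex.mul_conj' _
    rw [h1]
    obtain ⟨i, hi⟩ := hx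
    have h2 : (0 : ℝ) < ‖partialAt W i x‖ ^ 2 := pow_pos (norm_pos_iff.mpr hi) 2
    have h3 : (0 : ℝ) < ∑ i, ‖partialAt W i x‖ ^ 2 :=
      Finset.sum_pos' (fun i _ => sq_nonneg ‖partialAt W i x‖) ⟨i, Finset.mem_univ i, h2⟩
    exact Complex.ofReal_ne_zero.mpr h3.ne'
  have hker : ∀ u : Fin (m + 1) → ℂ, ∑ i, partialAt W i x * u i = 0 → D u = 0 := by
    intro u hu
    have key : ∃ y : Fin (m + 1) → ℂ, y ≠ 0 ∧
        (Matrix.of (Fin.cons u v : Fin (m + 1) → Fin (m + 1) → ℂ)).mulVec y = 0 := by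
      refine ⟨fun i => partialAt W i x, ?_, ?_⟩
      · obtain ⟨i, hi⟩ := hx
        exact fun h0 => hi (congrFun h0 i)
      · ext i
        refine Fin.cases ?_ (fun i => ?_) i
        · simpa [Matrix.mulVec, dotProduct, mul_comm] using hu
        · simpa [Matrix.mulVec, dotProduct, mul_comm] using hv i
    exact Matrix.exists_mulVec_eq_zero_iff.mp key
  have hlin : D ((∑ i, partialAt W i x * n i) • ν - (∑ i, partialAt W i x * ν i) • n)
      = (∑ i, partialAt W i x * n i) * D ν - (∑ i, partialAt W i x * ν i) * D n := by
    simp only [hupd, sub_eq_add_neg, ← neg_smul]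
    rw [Matrix.det_updateRow_add, Matrix.det_updateRow_smul, Matrix.det_updateRow_smul]
    ring
  rw [hker] at hlin
  · change _ * (D n / _) = D ν
    rw [mul_div_assoc', div_eq_iff hc]
    linear_combination hlin
  · simp only [Pi.sub_apply, Pi.smul_apply, smul_eq_mul, mul_sub, Finset.sum_sub_distrib]
    have e : ∀ (c : ℂ) (y : Fin (m + 1) → ℂ),
        ∑ i, partialAt W i x * (c * y i) = c * ∑ i, partialAt W i x * y i := by
      intro c y
      rw [Finset.mul_sum]
      exact Finset.sum_congr rfl fun i _ => by ring
    rw [e, e]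
    ring

/-- A `g`-equivariant unitary frame (trivialization) along `γ(t) = R_t p`, `t ∈ [0, l]`, of the tangent
bundle of the Milnor fiber with its complex structure and the symplectic form `dλ`. -/
structure IsUnitaryFrame {m : ℕ} (W : MvPolynomial (Fin (m + 1)) ℂ) (w : Fin (m + 1) → ℕ) (h : ℕ)
    (g : Fin (m + 1) → ℂˣ) (l : ℝ) (p : Fin (m + 1) → ℂ)
    (F : ℝ → Fin m → Fin (m + 1) → ℂ) : Prop where
  contDiffOn : ContDiffOn ℝ 1 F (Set.Icc 0 l)
  tangent : ∀ t ∈ Set.Icc 0 l, ∀ j, F t j ∈ tangentSpace W (reebFlow w h t p)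
  unitary : ∀ t ∈ Set.Icc 0 l, ∀ i j, herm w (F t i) (F t j) = if i = j then 1 else 0
  equivariant : ∀ j, act g (F l j) = F 0 j

/-- The linearized Reeb flow `T_p → T_{γ(t)}` written in the frame `F`: the unitary matrix `A(t)` with
`R_t (F(0)ⱼ) = ∑ᵢ A(t)ᵢⱼ F(t)ᵢ`, as a real endomorphism of `ℂᵐ = ℝ²ᵐ`. -/
def linearizedFlow {m : ℕ} (w : Fin (m + 1) → ℕ) (h : ℕ) (F : ℝ → Fin m → Fin (m + 1) → ℂ)
    (t : ℝ) : EuclideanSpace ℂ (Fin m) →L[ℝ] EuclideanSpace ℂ (Fin m) :=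
  (Matrix.toEuclideanCLM (𝕜 := ℂ)
    (Matrix.of fun i j => herm w (F t i) (reebFlow w h t (F 0 j)))).restrictScalars ℝ

/-- `μ` is the (fractional) Robbin–Salamon index, with respect to the volume form `Ω`, of the
linearized Reeb flow along the `g`-twisted Reeb orbit `γ(t) = R_t p`, `t ∈ [0, l]`: the index of the
linearized flow in a `g`-equivariant unitary frame, plus twice the rotation number of the frame with
respect to `Ω`.  If `g` has order dividing `N`, then `Ω(F)^N` is a loop and `N` times the rotation
number is its winding number, so this is `1 / N` times the index with respect to `Ω^{⊗N}`. -/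
def IsRobbinSalamonIndex {m : ℕ} (W : MvPolynomial (Fin (m + 1)) ℂ) (w : Fin (m + 1) → ℕ) (h : ℕ)
    (g : Fin (m + 1) → ℂˣ) (l : ℝ) (p : Fin (m + 1) → ℂ) (μ : ℝ) : Prop :=
  ∃ (F : ℝ → Fin m → Fin (m + 1) → ℂ) (ρ : ℝ),
    IsUnitaryFrame W w h g l p F ∧
    RobbinSalamon.IsRegularPath (linearizedFlow w h F) 0 l ∧
    RobbinSalamon.IsRotationNumber (fun t => residueForm W (reebFlow w h t p) (F t)) 0 l ρ ∧
    μ = RobbinSalamon.index (linearizedFlow w h F) 0 l + 2 * ρ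

end LGOrbifold

/-!
The function `Q s - 2 * s` is `1`-periodic, hence a function `defect` of `exp (2πis)` on the unit
circle. It jumps only at `1`, by the sign with which an eigenvalue of a unitary path passes through
`1`, and it decreases at twice the rate of the rotation of the eigenvalue. Adding up these
contributions, the index of a path of unitary matrices is the change of the sum of the defects of
the eigenvalues, plus twice the rotation number of the determinant.

Along a Reeb orbit, the rotation of the determinant of the linearized flow in a frame and the
rotation of the residue form on the frame add up to the rotation `l * (∑ᵢ wᵢ / h - 1)` of the
residue form under the flow, whatever the frame. At the end point of the orbit the matrix of the
flow represents `g R_l` on the tangent space, and on `ℂⁿ` this diagonal map has one more eigenvalue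
`exp (2πil)`, in the normal direction. Its eigenvalue is also `exp (2πil)` at every index of `Iᶜ`,
where `∂ᵢW` does not vanish on the fixed space.

A frame is obtained by unwinding the flow: `g R_l` preserves the tangent space at `p`, so there is
an orthonormal basis of eigenvectors, and rotating each of them back along the flow closes it up.
In this frame the flow is the diagonal path with entries `exp (2πi t sⱼ)`; the speeds `sⱼ` are
determined modulo `1 / l`, and taking them positive makes all crossings regular.
-/

namespace RobbinSalamon

/-! ### The defect of a point of the unit circle -/

theorem Q_add_int (s : ℝ) (k : ℤ) : Q (s + k) = Q s + 2 * k := by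
  have int_iff : (∃ j : ℤ, (j : ℝ) = s + k) ↔ ∃ j : ℤ, (j : ℝ) = s :=
    ⟨fun ⟨j, hj⟩ => ⟨j - k, by push_cast; linarith⟩,
      fun ⟨j, hj⟩ => ⟨j + k, by push_cast; linarith⟩⟩
  by_cases hs : ∃ j : ℤ, (j : ℝ) = s
  · rw [Q, Q, if_pos hs, if_pos (int_iff.mpr hs)]
    ring
  · rw [Q, Q, if_neg hs, if_neg (mt int_iff.mp hs), Int.floor_add_intCast]
    push_cast
    ring

theorem Q_eq_sign {s : ℝ} (hs : |s| < 1) : Q s = SignType.sign s := by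
  obtain ⟨hs₁, hs₂⟩ := abs_lt.mp hs
  have not_int (h0 : s ≠ 0) : ¬ ∃ k : ℤ, (k : ℝ) = s := by
    rintro ⟨k, rfl⟩
    exact h0 (by exact_mod_cast Int.abs_lt_one_iff.mp (by exact_mod_cast hs))
  rcases lt_trichotomy s 0 with h | rfl | h
  · have floor_eq : ⌊s⌋ = -1 :=
      Int.floor_eq_iff.mpr ⟨by push_cast; linarith, by push_cast; linarith⟩
    rw [Q, if_neg (not_int h.ne), floor_eq, sign_neg h]
    norm_num
  · simp [Q]
  · have floor_eq : ⌊s⌋ = 0 :=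
      Int.floor_eq_iff.mpr ⟨by push_cast; linarith, by push_cast; linarith⟩
    rw [Q, if_neg (not_int h.ne'), floor_eq, sign_pos h]
    norm_num

/-- The function on the unit circle induced by the `1`-periodic function `s ↦ Q s - 2 * s` through
`s ↦ exp (2πis)`.  On eigenvalues it measures the difference between the Robbin–Salamon index and
twice the rotation. -/
def defect (z : ℂ) : ℝ := Q (z.arg / (2 * Real.pi)) - z.arg / Real.pi

theorem defect_exp_mul_I (θ : ℝ) :
    defect (Complex.exp (θ * Complex.I)) = Q (θ / (2 * Real.pi)) - θ / Real.pi := by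
  obtain ⟨k, hk⟩ : ∃ k : ℤ, (Complex.exp (θ * Complex.I)).arg = θ + k * (2 * Real.pi) := by
    refine ⟨-toIocDiv Real.two_pi_pos (-Real.pi) θ, ?_⟩
    rw [Complex.arg_exp_mul_I, toIocMod, zsmul_eq_mul, Int.cast_neg]
    ring
  have arg_shift_div_two_pi :
      (θ + k * (2 * Real.pi)) / (2 * Real.pi) = θ / (2 * Real.pi) + k := by field_simp
  have arg_shift_div_pi :
      (θ + k * (2 * Real.pi)) / Real.pi = θ / Real.pi + 2 * k := by field_simp
  rw [defect, hk, arg_shift_div_two_pi, arg_shift_div_pi, Q_add_int]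
  ring

theorem defect_exp_two_pi_mul (s : ℝ) :
    defect (Complex.exp (2 * Real.pi * Complex.I * s)) = Q s - 2 * s := by
  have h : 2 * Real.pi * Complex.I * s = (2 * Real.pi * s : ℝ) * Complex.I := by push_cast; ring
  rw [h, defect_exp_mul_I]
  congr 2 <;> field_simp

theorem defect_one : defect 1 = 0 := by
  simp [defect, Q]

theorem defect_exp_eq_sign_sub {θ : ℝ} (hθ : |θ| < 2 * Real.pi) :
    defect (Complex.exp (θ * Complex.I)) = SignType.sign θ - θ / Real.pi := by
  have hlt : |θ / (2 * Real.pi)| < 1 := by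
    rwa [abs_div, abs_of_pos Real.two_pi_pos, div_lt_one Real.two_pi_pos]
  have hsign : SignType.sign (θ / (2 * Real.pi)) = SignType.sign θ := by
    rw [div_eq_mul_inv, sign_mul, sign_pos (inv_pos.mpr Real.two_pi_pos), mul_one]
  rw [defect_exp_mul_I, Q_eq_sign hlt, hsign]

theorem im_exp_mul_exp_sub_one (α θ : ℝ) :
    (Complex.exp (-(α / 2) * Complex.I) * (Complex.exp (θ * Complex.I) - 1)).im
      = 2 * Real.cos ((θ - α) / 2) * Real.sin (θ / 2) := by
  have h : Complex.exp (-(α / 2) * Complex.I) * (Complex.exp (θ * Complex.I) - 1)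
      = Complex.exp ((θ - α / 2 : ℝ) * Complex.I) - Complex.exp ((-(α / 2) : ℝ) * Complex.I) := by
    rw [mul_sub, ← Complex.exp_add, mul_one]
    push_cast
    ring_nf
  rw [h, Complex.sub_im, Complex.exp_ofReal_mul_I_im, Complex.exp_ofReal_mul_I_im,
    Real.sin_sub_sin]
  ring_nf

theorem sign_im_exp_mul_exp_sub_one {α θ : ℝ} (hα : |α| < Real.pi) (hθ : |θ - α| < Real.pi) :
    SignType.sign (Complex.exp (-(α / 2) * Complex.I) * (Complex.exp (θ * Complex.I) - 1)).im
      = SignType.sign θ := by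
  obtain ⟨hα₁, hα₂⟩ := abs_lt.mp hα
  obtain ⟨hθ₁, hθ₂⟩ := abs_lt.mp hθ
  have hcos : 0 < Real.cos ((θ - α) / 2) :=
    Real.cos_pos_of_mem_Ioo ⟨by linarith, by linarith⟩
  rw [im_exp_mul_exp_sub_one, sign_mul, sign_pos (by positivity), one_mul]
  rcases lt_trichotomy θ 0 with h | rfl | h
  · rw [sign_neg h, sign_neg (Real.sin_neg_of_neg_of_neg_pi_lt (by linarith) (by linarith))]
  · simp
  · rw [sign_pos h, sign_pos (Real.sin_pos_of_pos_of_lt_pi (by linarith) (by linarith))]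

theorem norm_exp_two_pi_mul (s : ℝ) : ‖Complex.exp (2 * Real.pi * Complex.I * s)‖ = 1 := by
  rw [show 2 * Real.pi * Complex.I * s = ((2 * Real.pi * s : ℝ) : ℂ) * Complex.I by
    push_cast; ring, Complex.norm_exp_ofReal_mul_I]

theorem conj_exp_two_pi_mul (s : ℝ) :
    (starRingEnd ℂ) (Complex.exp (2 * Real.pi * Complex.I * s)) =
      Complex.exp (2 * Real.pi * Complex.I * ((-s : ℝ) : ℂ)) := by
  rw [← Complex.exp_conj]
  congr 1
  simp only [map_mul, map_ofNat, Complex.conj_ofReal, Complex.conj_I]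
  push_cast
  ring

/-! ### Functions with finitely many jumps -/

section Jumps

open Filter Set Topology

theorem eventually_sign_sub_eq {u v : ℝ} (huv : u ≠ v) :
    ∀ᶠ t in 𝓝 u, SignType.sign (t - v) = SignType.sign (u - v) := by
  have hcont : ContinuousAt (fun t => SignType.sign (t - v)) u :=
    (continuousAt_sign_of_ne_zero (sub_ne_zero.mpr huv)).comp (f := fun t => t - v) (by fun_prop)
  exact hcont.eventually_mem (IsOpen.mem_nhds (isOpen_discrete {_}) rfl)

variable {f s : ℝ → ℝ} {a b : ℝ}

theorem eventually_jump_eq_zero (hab : a < b)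
    (hf : ∀ u ∈ Icc a b, ∀ᶠ t in 𝓝[Icc a b] u, f t = f u + SignType.sign (t - u) * s u)
    {u : ℝ} (hu : u ∈ Icc a b) : ∀ᶠ t in 𝓝[Icc a b] u, t ≠ u → s t = 0 := by
  filter_upwards [eventually_eventually_nhdsWithin.mpr (hf u hu), self_mem_nhdsWithin]
    with t ht htab htu
  have : (𝓝[Icc a b \ {t}] t).NeBot := by
    have nontrivial : (Icc a b).Nontrivial :=
      ⟨a, left_mem_Icc.mpr hab.le, b, right_mem_Icc.mpr hab.le, hab.ne⟩
    exact accPt_principal_iff_nhdsWithin.mp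
      (isPreconnected_Icc.preperfect_of_nontrivial nontrivial t htab)
  obtain ⟨v, hv, hvt⟩ : ∃ v, (f v = f t + SignType.sign (v - t) * s t ∧ f v = f t) ∧ v ≠ t := by
    have hle : 𝓝[Icc a b \ {t}] t ≤ 𝓝[Icc a b] t := nhdsWithin_mono _ sdiff_subset
    have hne : ∀ᶠ v in 𝓝[Icc a b \ {t}] t, v ≠ t :=
      eventually_nhdsWithin_of_forall fun v hv => hv.2
    refine Eventually.exists (f := 𝓝[Icc a b \ {t}] t) ?_
    filter_upwards [hle ht, mem_nhdsWithin_of_mem_nhds (eventually_sign_sub_eq htu),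
      hle (hf t htab), hne] with v h₁ h₂ h₃ h₄
    refine ⟨⟨h₃, ?_⟩, h₄⟩
    rw [h₁, h₂, ht.self_of_nhdsWithin htab]
  have hsign : (SignType.sign (v - t) : ℝ) * s t = 0 := by linarith [hv.1, hv.2]
  refine (mul_eq_zero.mp hsign).resolve_left ?_
  rcases hvt.lt_or_gt with h | h
  · simp [sign_neg (sub_neg.mpr h)]
  · simp [sign_pos (sub_pos.mpr h)]

theorem finite_setOf_jump_ne_zero (hab : a < b)
    (hf : ∀ u ∈ Icc a b, ∀ᶠ t in 𝓝[Icc a b] u, f t = f u + SignType.sign (t - u) * s u) :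
    {u ∈ Icc a b | s u ≠ 0}.Finite := by
  suffices h : (Icc a b ∩ {u | s u ≠ 0}).Finite from h
  refine isCompact_Icc.induction_on (p := fun S => (S ∩ {u | s u ≠ 0}).Finite) (by simp)
    (fun S T hST hT => hT.subset (inter_subset_inter_left _ hST))
    (fun S T hS hT => by rw [union_inter_distrib_right]; exact hS.union hT) fun u hu => ?_
  refine ⟨_, eventually_jump_eq_zero hab hf hu, (finite_singleton u).subset ?_⟩
  rintro t ⟨ht, hst⟩
  by_contra htu
  exact hst (ht htu)

theorem eq_of_eventually_eq (hab : a ≤ b)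
    (hf : ∀ u ∈ Icc a b, ∀ᶠ t in 𝓝[Icc a b] u, f t = f u) : f b = f a := by
  have hder (u : ℝ) (hu : u ∈ Icc a b) : HasDerivWithinAt f 0 (Icc a b) u :=
    (hasDerivWithinAt_const u _ (f u)).congr_of_eventuallyEq (hf u hu) rfl
  refine constant_of_derivWithin_zero (fun u hu => (hder u hu).differentiableWithinAt)
    (fun u hu => ?_) b (right_mem_Icc.mpr hab)
  rcases hab.eq_or_lt with rfl | hlt
  · simp at hu
  · exact (hder u (Ico_subset_Icc_self hu)).derivWithin
      (uniqueDiffOn_Icc hlt u (Ico_subset_Icc_self hu))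

theorem sub_eq_sum_sign_sub_mul (hab : a ≤ b)
    (hf : ∀ u ∈ Icc a b, ∀ᶠ t in 𝓝[Icc a b] u, f t = f u + SignType.sign (t - u) * s u)
    {Z : Finset ℝ} (hZ : ∀ u ∈ Icc a b, u ∉ Z → s u = 0) :
    f b - f a = ∑ u ∈ Z, SignType.sign (b - u) * s u - ∑ u ∈ Z, SignType.sign (a - u) * s u := by
  suffices hconst : f b - ∑ u ∈ Z, SignType.sign (b - u) * s u
      = f a - ∑ u ∈ Z, SignType.sign (a - u) * s u by linarith
  refine eq_of_eventually_eq (f := fun t => f t - ∑ u ∈ Z, SignType.sign (t - u) * s u)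
    hab fun v hv => ?_
  have hsign : ∀ᶠ t in 𝓝[Icc a b] v,
      ∀ u ∈ Z, v ≠ u → SignType.sign (t - u) = SignType.sign (v - u) :=
    mem_nhdsWithin_of_mem_nhds ((Finset.eventually_all Z).mpr fun u _ => by
      by_cases huv : v = u
      · simp [huv]
      · simpa [huv] using eventually_sign_sub_eq huv)
  filter_upwards [hf v hv, hsign] with t hft ht
  have hsum : ∑ u ∈ Z, SignType.sign (t - u) * s u - ∑ u ∈ Z, SignType.sign (v - u) * s u
      = SignType.sign (t - v) * s v := by
    rw [← Finset.sum_sub_distrib]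
    refine (Finset.sum_eq_single v (fun u hu huv => ?_) fun hvZ => ?_).trans (by simp)
    · rw [ht u hu huv.symm, sub_self]
    · simp [hZ v hv hvZ]
  linarith

theorem sub_eq_sum_jumps (hab : a < b)
    (hf : ∀ u ∈ Icc a b, ∀ᶠ t in 𝓝[Icc a b] u, f t = f u + SignType.sign (t - u) * s u) :
    f b - f a = s a + 2 * ∑ᶠ u ∈ Ioo a b, s u + s b := by
  classical
  set Z := ((finite_setOf_jump_ne_zero hab hf).subset
    (fun u (hu : u ∈ Ioo a b ∩ Function.support s) => ⟨Ioo_subset_Icc_self hu.1, hu.2⟩)).toFinset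
    with hZ
  have mem_Z {u : ℝ} : u ∈ Z ↔ u ∈ Ioo a b ∧ s u ≠ 0 := by simp [hZ]
  have jump_eq_zero (u : ℝ) (hu : u ∈ Icc a b) (huZ : u ∉ insert a (insert b Z)) : s u = 0 := by
    simp only [Finset.mem_insert, mem_Z, not_or, not_and, not_not] at huZ
    exact huZ.2.2 ⟨hu.1.lt_of_ne' huZ.1, hu.2.lt_of_ne huZ.2.1⟩
  have ha : a ∉ insert b Z := by simp [mem_Z, hab.ne]
  have hb : b ∉ Z := by simp [mem_Z]
  have hbZ : ∑ u ∈ Z, (SignType.sign (b - u) : ℝ) * s u = ∑ u ∈ Z, s u :=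
    Finset.sum_congr rfl fun u hu => by
      rw [sign_pos (sub_pos.mpr (mem_Z.mp hu).1.2), SignType.coe_one, one_mul]
  have haZ : ∑ u ∈ Z, (SignType.sign (a - u) : ℝ) * s u = -∑ u ∈ Z, s u := by
    rw [← Finset.sum_neg_distrib]
    refine Finset.sum_congr rfl fun u hu => ?_
    rw [sign_neg (sub_neg.mpr (mem_Z.mp hu).1.1), SignType.coe_neg_one, neg_one_mul]
  rw [finsum_mem_eq_sum_of_inter_support_eq (t := Z) s (by ext u; simp [mem_Z]),
    sub_eq_sum_sign_sub_mul hab.le hf jump_eq_zero]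
  simp only [Finset.sum_insert ha, Finset.sum_insert hb, hbZ, haZ, sub_self, sign_zero,
    sign_pos (sub_pos.mpr hab), sign_neg (sub_neg.mpr hab), SignType.coe_zero, SignType.coe_one,
    SignType.coe_neg_one]
  ring

end Jumps

/-! ### The signature of a perturbed quadratic form -/

section Signature

variable {E : Type*} [AddCommGroup E] [Module ℝ E]

/-- The signature of a real quadratic form: its positive index minus its negative index. -/
def signature (q : QuadraticForm ℝ E) : ℝ := (sigPos q : ℝ) - sigNeg q

theorem signature_neg (q : QuadraticForm ℝ E) : signature (-q) = -signature q := by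
  rw [signature, signature, sigNeg, sigNeg, neg_neg, neg_sub]

theorem radical_smul {c : ℝ} (hc : c ≠ 0) (q : QuadraticForm ℝ E) :
    (c • q).radical = q.radical := by
  ext v
  simp [QuadraticMap.mem_radical_iff', hc]

theorem radical_neg (q : QuadraticForm ℝ E) : (-q).radical = q.radical := by
  rw [← neg_one_smul ℝ q, radical_smul (neg_ne_zero.mpr one_ne_zero)]

theorem restrict_neg (q : QuadraticForm ℝ E) (V : Submodule ℝ E) :
    (-q).restrict V = -q.restrict V := by
  ext v
  rfl

theorem signature_eq_of_equivalent {F : Type*} [AddCommGroup F] [Module ℝ F]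
    {q : QuadraticForm ℝ E} {q' : QuadraticForm ℝ F} (e : q.Equivalent q') :
    signature q = signature q' := by
  rw [signature, signature, e.sigPos_eq, e.sigNeg_eq]

theorem signature_smul {c : ℝ} (hc : 0 < c) (q : QuadraticForm ℝ E) :
    signature (c • q) = signature q := by
  refine signature_eq_of_equivalent
    ⟨⟨LinearEquiv.smulOfNeZero ℝ E (√c) (Real.sqrt_pos.mpr hc).ne', fun x => ?_⟩⟩
  change q (√c • x) = c • q x
  rw [QuadraticMap.map_smul, Real.mul_self_sqrt hc.le]

theorem signature_weightedSumSquares {ι : Type*} [Fintype ι] (w : ι → ℝ) :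
    signature (QuadraticMap.weightedSumSquares ℝ w) = ∑ i, (SignType.sign (w i) : ℝ) := by
  classical
  have sign_eq (i : ι) : (SignType.sign (w i) : ℝ)
      = (if 0 < w i then 1 else 0) - if w i < 0 then 1 else 0 := by
    rcases lt_trichotomy (w i) 0 with h | h | h
    · simp [h, h.not_gt]
    · simp [h]
    · simp [h, h.not_gt]
  simp only [signature, QuadraticForm.sigPos_weightedSumSquares,
    QuadraticForm.sigNeg_weightedSumSquares, sign_eq, Finset.sum_sub_distrib, Finset.sum_boole,
    Set.ncard_eq_toFinset_card', Set.toFinset_ofPred]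

end Signature

section Perturbation

open Filter Topology

variable {E : Type*} [NormedAddCommGroup E] [NormedSpace ℝ E]

theorem abs_le_of_abs_polar_le {q : QuadraticForm ℝ E} {C : ℝ}
    (hC : ∀ u v, |QuadraticMap.polar q u v| ≤ C * (‖u‖ * ‖v‖)) (v : E) :
    |q v| ≤ C / 2 * ‖v‖ ^ 2 := by
  have h := hC v v
  rw [QuadraticMap.polar_self, nsmul_eq_mul, Nat.cast_ofNat, abs_mul, abs_two] at h
  linarith

variable [FiniteDimensional ℝ E]

theorem continuous_quadraticForm (q : QuadraticForm ℝ E) : Continuous q := by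
  have h : Continuous fun v : E =>
      (QuadraticMap.associated (R := ℝ) q).toContinuousBilinearMap v v := by fun_prop
  exact h.congr fun v => QuadraticMap.associated_eq_self_apply ℝ q v

theorem exists_abs_polar_le (q : QuadraticForm ℝ E) :
    ∃ C > 0, ∀ u v, |QuadraticMap.polar q u v| ≤ C * (‖u‖ * ‖v‖) := by
  let B := (QuadraticMap.polarBilin q).toContinuousBilinearMap
  refine ⟨‖B‖ + 1, by positivity, fun u v => ?_⟩
  have hB : |QuadraticMap.polar q u v| ≤ ‖B‖ * ‖u‖ * ‖v‖ := B.le_opNorm₂ u v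
  linarith [mul_nonneg (norm_nonneg u) (norm_nonneg v)]

theorem exists_mul_sq_norm_le {q : QuadraticForm ℝ E} {V : Submodule ℝ E}
    (hq : (q.restrict V).PosDef) : ∃ c > 0, ∀ v ∈ V, c * ‖v‖ ^ 2 ≤ q v := by
  have hpos (v : E) (hv : v ∈ V) (h0 : v ≠ 0) : 0 < q v :=
    hq ⟨v, hv⟩ (by simpa [Subtype.ext_iff] using h0)
  have hcompact : IsCompact ((V : Set E) ∩ Metric.sphere 0 1) :=
    (isCompact_sphere 0 1).inter_left V.closed_of_finiteDimensional
  have normalize_mem {v : E} (hv : v ∈ V) (hv0 : v ≠ 0) :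
      ‖v‖⁻¹ • v ∈ (V : Set E) ∩ Metric.sphere 0 1 :=
    ⟨V.smul_mem _ hv, by simp [norm_smul, hv0]⟩
  rcases ((V : Set E) ∩ Metric.sphere 0 1).eq_empty_or_nonempty with hempty | hne
  · refine ⟨1, one_pos, fun v hv => ?_⟩
    by_cases hv0 : v = 0
    · simp [hv0]
    · exact absurd (hempty ▸ normalize_mem hv hv0) (Set.notMem_empty _)
  · obtain ⟨x, hx, hmin⟩ := hcompact.exists_isMinOn hne (continuous_quadraticForm q).continuousOn
    have hx0 : x ≠ 0 := Metric.ne_of_mem_sphere hx.2 one_ne_zero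
    refine ⟨q x, hpos x hx.1 hx0, fun v hv => ?_⟩
    by_cases hv0 : v = 0
    · simp [hv0]
    have hle : q x ≤ q (‖v‖⁻¹ • v) := hmin (normalize_mem hv hv0)
    rw [QuadraticMap.map_smul, smul_eq_mul] at hle
    calc q x * ‖v‖ ^ 2 ≤ (‖v‖⁻¹ * ‖v‖⁻¹ * q v) * ‖v‖ ^ 2 := by gcongr
      _ = q v := by field_simp

theorem add_sq_le_of_bounds {c C τ x y n qa ra rb p e : ℝ} (hc : 0 < c) (hτ : 0 ≤ τ)
    (hqa : c * x ^ 2 ≤ qa) (hrb : c * y ^ 2 ≤ rb) (hra : |ra| ≤ C * x ^ 2)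
    (hp : |p| ≤ C * (x * y)) (hn : n ^ 2 ≤ 2 * (x ^ 2 + y ^ 2))
    (he : |e| ≤ c / 8 * (τ * n ^ 2)) :
    (c - τ * (C + C ^ 2 / (2 * c) + c / 4)) * x ^ 2 + τ * (c / 4) * y ^ 2
      ≤ qa + τ * (ra + rb + p) + e := by
  have am_gm : C * (x * y) ≤ c / 2 * y ^ 2 + C ^ 2 / (2 * c) * x ^ 2 := by
    have h : c / 2 * y ^ 2 + C ^ 2 / (2 * c) * x ^ 2 - C * (x * y)
        = (c * y - C * x) ^ 2 / (2 * c) := by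
      field_simp
      ring
    have : 0 ≤ (c * y - C * x) ^ 2 / (2 * c) := by positivity
    linarith
  have hfirst : τ * (c / 2 * y ^ 2 - (C + C ^ 2 / (2 * c)) * x ^ 2) ≤ τ * (ra + rb + p) := by
    refine mul_le_mul_of_nonneg_left ?_ hτ
    linarith [(abs_le.mp hra).1, (abs_le.mp hp).1]
  have herror : c / 8 * (τ * n ^ 2) ≤ c / 8 * (τ * (2 * (x ^ 2 + y ^ 2))) := by gcongr
  linarith [(abs_le.mp he).1]

variable {ι : Type*} {l : Filter ι} {q r : QuadraticForm ℝ E} {τ : ι → ℝ}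
  {p : ι → QuadraticForm ℝ E}

theorem eventually_posDef_restrict_sup (hτ : Tendsto τ l (𝓝[>] 0))
    (hp : ∀ ε > 0, ∀ᶠ i in l, ∀ v, |p i v - q v - τ i * r v| ≤ ε * (τ i * ‖v‖ ^ 2))
    {V K : Submodule ℝ E} (hV : (q.restrict V).PosDef) (hK : (r.restrict K).PosDef)
    (hqK : ∀ b ∈ K, ∀ a, q (a + b) = q a) : ∀ᶠ i in l, ((p i).restrict (V ⊔ K)).PosDef := by
  obtain ⟨c₁, hc₁, hqV⟩ := exists_mul_sq_norm_le hV
  obtain ⟨c₂, hc₂, hrK⟩ := exists_mul_sq_norm_le hK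
  obtain ⟨C, hC, hpolar⟩ := exists_abs_polar_le r
  set c := min c₁ c₂
  have hc : 0 < c := lt_min hc₁ hc₂
  have hτ_lt : ∀ᶠ i in l, τ i < c / (C + C ^ 2 / (2 * c) + c / 4) :=
    (hτ.mono_right nhdsWithin_le_nhds).eventually_lt_const (by positivity)
  filter_upwards [hτ_lt, hτ self_mem_nhdsWithin, hp (c / 8) (by positivity)] with i hlt hi hpi
  have hcoeff : 0 < c - τ i * (C + C ^ 2 / (2 * c) + c / 4) :=
    sub_pos.mpr ((lt_div_iff₀ (by positivity)).mp hlt)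
  rintro ⟨v, hv⟩ hv0
  obtain ⟨a, ha, b, hb, rfl⟩ := Submodule.mem_sup.mp hv
  have hbound := add_sq_le_of_bounds hc hi.le (x := ‖a‖) (y := ‖b‖) (n := ‖a + b‖)
    (le_trans (by gcongr; exact min_le_left _ _) (hqV a ha))
    (le_trans (by gcongr; exact min_le_right _ _) (hrK b hb))
    ((abs_le_of_abs_polar_le hpolar a).trans (by gcongr; linarith)) (hpolar a b)
    ((pow_le_pow_left₀ (norm_nonneg _) (norm_add_le a b) 2).trans add_sq_le) (hpi (a + b))
  have hpab : q a + τ i * (r a + r b + QuadraticMap.polar r a b)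
      + (p i (a + b) - q (a + b) - τ i * r (a + b)) = p i (a + b) := by
    rw [hqK b hb a, QuadraticMap.polar]
    ring
  change 0 < p i (a + b)
  rw [← hpab]
  refine lt_of_lt_of_le ?_ hbound
  have hi : 0 < τ i := hi
  by_cases ha0 : a = 0
  · have hb0 : b ≠ 0 := by
      rintro rfl
      exact hv0 (by simp [ha0])
    simp only [ha0, norm_zero]
    have := norm_pos_iff.mpr hb0
    positivity
  · have := norm_pos_iff.mpr ha0
    positivity

theorem exists_posDef_restrict_le (q : QuadraticForm ℝ E) (R : Submodule ℝ E) :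
    ∃ K ≤ R, Module.finrank ℝ K = sigPos (q.restrict R) ∧ (q.restrict K).PosDef := by
  obtain ⟨K, hrank, hK⟩ := exists_finrank_eq_sigPos_and_posDef (q.restrict R)
  refine ⟨K.map R.subtype, Submodule.map_subtype_le R K, ?_, ?_⟩
  · rw [← hrank]
    exact (Submodule.equivMapOfInjective _ (Submodule.injective_subtype R) K).symm.finrank_eq
  · rintro ⟨_, v, hv, rfl⟩ h0
    exact hK ⟨v, hv⟩ fun h => h0 (by simpa using h)

theorem eventually_sigPos_add_le (hτ : Tendsto τ l (𝓝[>] 0))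
    (hp : ∀ ε > 0, ∀ᶠ i in l, ∀ v, |p i v - q v - τ i * r v| ≤ ε * (τ i * ‖v‖ ^ 2)) :
    ∀ᶠ i in l, sigPos q + sigPos (r.restrict q.radical) ≤ sigPos (p i) := by
  obtain ⟨V, hVrank, hV⟩ := exists_finrank_eq_sigPos_and_posDef q
  obtain ⟨K, hKR, hKrank, hK⟩ := exists_posDef_restrict_le r q.radical
  have hqK (b : E) (hb : b ∈ K) (a : E) : q (a + b) = q a := by
    rw [add_comm]
    exact (QuadraticMap.mem_radical_iff'.mp (hKR hb)).2 a
  have hdisj : Disjoint V K := by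
    refine Submodule.disjoint_def.mpr fun x hxV hxK => ?_
    by_contra hx0
    have hpos : 0 < q x := hV ⟨x, hxV⟩ (by simpa [Subtype.ext_iff] using hx0)
    have hzero : q x = 0 := by simpa using hqK x hxK 0
    exact hpos.ne' hzero
  filter_upwards [eventually_posDef_restrict_sup hτ hp hV hK hqK] with i hi
  have hrank := Submodule.finrank_sup_add_finrank_inf_eq V K
  rw [hdisj.eq_bot, finrank_bot, add_zero] at hrank
  have := le_sigPos_of_posDef (p i) hi
  lia

theorem eventually_signature_eq_add (hnd : (r.restrict q.radical).radical = ⊥)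
    (hτ : Tendsto τ l (𝓝[>] 0))
    (hp : ∀ ε > 0, ∀ᶠ i in l, ∀ v, |p i v - q v - τ i * r v| ≤ ε * (τ i * ‖v‖ ^ 2)) :
    ∀ᶠ i in l, signature (p i) = signature q + signature (r.restrict q.radical) := by
  have hneg : ∀ ε > 0, ∀ᶠ i in l, ∀ v,
      |(-p i) v - (-q) v - τ i * (-r) v| ≤ ε * (τ i * ‖v‖ ^ 2) := fun ε hε => by
    filter_upwards [hp ε hε] with i hi v
    rw [← abs_neg]
    convert hi v using 2
    simp only [neg_apply]
    ring
  have hsigNeg := eventually_sigPos_add_le hτ hneg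
  rw [radical_neg] at hsigNeg
  filter_upwards [eventually_sigPos_add_le hτ hp, hsigNeg] with i hle_pos hle_neg
  have hle_neg : sigNeg q + sigNeg (r.restrict q.radical) ≤ sigNeg (p i) := hle_neg
  have rank_q := QuadraticForm.sigPos_add_sigNeg_add_radical (Q := q)
  have rank_r := QuadraticForm.sigPos_add_sigNeg_add_radical (Q := r.restrict q.radical)
  have rank_p := QuadraticForm.sigPos_add_sigNeg_add_radical (Q := p i)
  rw [hnd, finrank_bot, add_zero] at rank_r
  have hpos_eq : sigPos (p i) = sigPos q + sigPos (r.restrict q.radical) := by lia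
  have hneg_eq : sigNeg (p i) = sigNeg q + sigNeg (r.restrict q.radical) := by lia
  simp only [signature, hpos_eq, hneg_eq, Nat.cast_add]
  ring

theorem eventually_signature_eq {q : ℝ → QuadraticForm ℝ E} {s : Set ℝ} {u : ℝ}
    (hnd : (r.restrict (q u).radical).radical = ⊥)
    (hq : ∀ ε > 0, ∀ᶠ t in 𝓝[s] u, ∀ v,
      |q t v - q u v - (t - u) * r v| ≤ ε * (|t - u| * ‖v‖ ^ 2)) :
    ∀ᶠ t in 𝓝[s] u, signature (q t)
      = signature (q u) + SignType.sign (t - u) * signature (r.restrict (q u).radical) := by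
  have hright : ∀ᶠ t in 𝓝[s ∩ Set.Ioi u] u,
      signature (q t) = signature (q u) + signature (r.restrict (q u).radical) := by
    refine eventually_signature_eq_add (τ := fun t => t - u) hnd
      (tendsto_nhdsWithin_iff.mpr ⟨?_, ?_⟩) fun ε hε => ?_
    · exact tendsto_nhdsWithin_of_tendsto_nhds (Continuous.tendsto' (by fun_prop) _ _ (sub_self u))
    · filter_upwards [self_mem_nhdsWithin] with t ht using sub_pos.mpr (Set.mem_Ioi.mp ht.2)
    · filter_upwards [nhdsWithin_mono u Set.inter_subset_left (hq ε hε), self_mem_nhdsWithin]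
        with t ht htu v
      simpa only [abs_of_pos (sub_pos.mpr (Set.mem_Ioi.mp htu.2))] using ht v
  have hleft : ∀ᶠ t in 𝓝[s ∩ Set.Iio u] u,
      signature (q t) = signature (q u) + signature ((-r).restrict (q u).radical) := by
    refine eventually_signature_eq_add (τ := fun t => u - t)
      (by rw [restrict_neg, radical_neg, hnd]) (tendsto_nhdsWithin_iff.mpr ⟨?_, ?_⟩) fun ε hε => ?_
    · exact tendsto_nhdsWithin_of_tendsto_nhds (Continuous.tendsto' (by fun_prop) _ _ (sub_self u))
    · filter_upwards [self_mem_nhdsWithin] with t ht using sub_pos.mpr (Set.mem_Iio.mp ht.2)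
    · filter_upwards [nhdsWithin_mono u Set.inter_subset_left (hq ε hε), self_mem_nhdsWithin]
        with t ht htu v
      convert ht v using 2
      · simp only [neg_apply]
        ring_nf
      · rw [abs_of_neg (sub_neg.mpr (Set.mem_Iio.mp htu.2)), neg_sub]
  rw [nhdsWithin_inter', eventually_inf_principal] at hright hleft
  filter_upwards [hright, hleft] with t hgt hlt
  rcases lt_trichotomy t u with h | rfl | h
  · simp [hlt h, restrict_neg, signature_neg, sign_neg (sub_neg.mpr h)]
  · simp
  · simp [hgt h, sign_pos (sub_pos.mpr h)]

end Perturbation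

/-! ### Diagonalizable operators -/

section Diagonal

variable {E : Type*} [NormedAddCommGroup E] [InnerProductSpace ℂ E]

/-- The sum of `r z` over the eigenvalues `z` of `T`, counted with algebraic multiplicity. -/
def spectralSum [FiniteDimensional ℂ E] (r : ℂ → ℝ) (T : E →L[ℂ] E) : ℝ :=
  (T.toLinearMap.charpoly.roots.map r).sum

section Real

variable [NormedSpace ℝ E] [IsScalarTower ℝ ℂ E]

/-- The real quadratic form `v ↦ Im (c ⟪v, L v⟫)`.  A suitable unit `c` makes it detect the sign of
the arguments of the eigenvalues of `L + 1`. -/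
def imForm (c : ℂ) (L : E →L[ℝ] E) : QuadraticForm ℝ E :=
  LinearMap.BilinMap.toQuadraticMap (LinearMap.mk₂ ℝ (fun u v => (c * inner ℂ u (L v)).im)
    (fun u u' v => by simp [mul_add])
    (fun r u v => by
      rw [inner_smul_left_eq_smul, mul_smul_comm, Complex.smul_im])
    (fun u v v' => by simp [mul_add])
    (fun r u v => by
      rw [map_smul, inner_smul_right_eq_smul, mul_smul_comm, Complex.smul_im]))

theorem imForm_apply (c : ℂ) (L : E →L[ℝ] E) (v : E) : imForm c L v = (c * inner ℂ v (L v)).im :=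
  rfl

theorem imForm_sub_sub_smul_apply (c : ℂ) (K L M : E →L[ℝ] E) (r : ℝ) (v : E) :
    imForm c (K - L - r • M) v = imForm c K v - imForm c L v - r * imForm c M v := by
  simp only [imForm_apply, sub_apply, smul_apply, inner_sub_right, inner_smul_right_eq_smul,
    mul_sub, mul_smul_comm, Complex.sub_im, Complex.smul_im, smul_eq_mul]

theorem abs_imForm_le (c : ℂ) (L : E →L[ℝ] E) (v : E) :
    |imForm c L v| ≤ ‖c‖ * ‖L‖ * ‖v‖ ^ 2 :=
  calc |imForm c L v| ≤ ‖c * inner ℂ v (L v)‖ := Complex.abs_im_le_norm _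
    _ = ‖c‖ * ‖inner ℂ v (L v)‖ := norm_mul _ _
    _ ≤ ‖c‖ * (‖v‖ * (‖L‖ * ‖v‖)) := by
      gcongr
      exact (norm_inner_le_norm _ _).trans (by gcongr; exact L.le_opNorm v)
    _ = ‖c‖ * ‖L‖ * ‖v‖ ^ 2 := by ring

end Real

variable {ι : Type*} [Fintype ι] {b : OrthonormalBasis ι ℂ E} {T : E →L[ℂ] E} {d : ι → ℂ}

theorem inner_apply_of_eigenbasis (hT : ∀ j, T (b j) = d j • b j) (j : ι) (v : E) :
    inner ℂ (b j) (T v) = d j * inner ℂ (b j) v := by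
  classical
  conv_lhs => rw [← b.sum_repr' v]
  simp [map_sum, hT, b.inner_eq_ite, mul_comm]

theorem toMatrix_of_eigenbasis [DecidableEq ι] (hT : ∀ j, T (b j) = d j • b j) :
    LinearMap.toMatrix b.toBasis b.toBasis T.toLinearMap = Matrix.diagonal d := by
  ext i j
  by_cases hij : i = j <;> simp [LinearMap.toMatrix_apply, hT, b.repr_self, hij]

theorem spectralSum_of_eigenbasis [FiniteDimensional ℂ E] (hT : ∀ j, T (b j) = d j • b j)
    (r : ℂ → ℝ) : spectralSum r T = ∑ j, r (d j) := by
  classical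
  have hroots : (∏ j, (Polynomial.X - Polynomial.C (d j))).roots
      = Finset.univ.val.map d := by
    rw [← Polynomial.roots_multiset_prod_X_sub_C (Finset.univ.val.map d), Multiset.map_map]
    rfl
  rw [spectralSum, ← LinearMap.charpoly_toMatrix T.toLinearMap b.toBasis,
    toMatrix_of_eigenbasis hT, Matrix.charpoly_diagonal, hroots, Multiset.map_map]
  rfl

theorem det_of_eigenbasis (hT : ∀ j, T (b j) = d j • b j) : T.det = ∏ j, d j := by
  classical
  rw [ContinuousLinearMap.det, ← LinearMap.det_toMatrix b.toBasis]
  exact (congrArg Matrix.det (toMatrix_of_eigenbasis hT)).trans Matrix.det_diagonal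

theorem apply_eq_zero_iff_of_eigenbasis (hT : ∀ j, T (b j) = d j • b j) (v : E) :
    T v = 0 ↔ ∀ j, d j = 0 ∨ inner ℂ (b j) v = 0 := by
  simp only [← mul_eq_zero, ← inner_apply_of_eigenbasis hT]
  exact ⟨fun h j => by rw [h, inner_zero_right], fun h =>
    InnerProductSpace.ext_inner_left_basis b.toBasis fun j => by simpa using h j⟩

variable [NormedSpace ℝ E] [IsScalarTower ℝ ℂ E]

theorem imForm_apply_eq_sum (hT : ∀ j, T (b j) = d j • b j) (c : ℂ) (v : E) :
    imForm c (T.restrictScalars ℝ) v = ∑ j, (c * d j).im * ‖inner ℂ (b j) v‖ ^ 2 := by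
  rw [imForm_apply, ContinuousLinearMap.coe_restrictScalars', ← b.sum_inner_mul_inner,
    Finset.mul_sum, Complex.im_sum]
  refine Finset.sum_congr rfl fun j _ => ?_
  have h : c * (inner ℂ v (b j) * (d j * inner ℂ (b j) v))
      = ((‖inner ℂ (b j) v‖ ^ 2 : ℝ) : ℂ) * (c * d j) := by
    rw [← inner_conj_symm v (b j)]
    push_cast
    rw [← Complex.conj_mul']
    ring
  rw [inner_apply_of_eigenbasis hT, h, Complex.im_ofReal_mul, mul_comm]

theorem exists_isometryEquiv_imForm (hT : ∀ j, T (b j) = d j • b j) (c : ℂ) :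
    ∃ e : (imForm c (T.restrictScalars ℝ)).IsometryEquiv
        (QuadraticMap.weightedSumSquares ℝ fun x : Fin 2 × ι => (c * d x.2).im),
      ∀ v x, e v x = Complex.basisOneI.repr (inner ℂ (b x.2) v) x.1 := by
  let e := (Complex.basisOneI.smulTower b.toBasis).equivFun
  have he (v : E) (x : Fin 2 × ι) :
      e v x = Complex.basisOneI.repr (inner ℂ (b x.2) v) x.1 := by
    simp [e, Module.Basis.smulTower_repr, b.repr_apply_apply]
  refine ⟨⟨e, fun v => ?_⟩, he⟩
  change QuadraticMap.weightedSumSquares ℝ _ (e v) = _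
  simp only [QuadraticMap.weightedSumSquares_apply, Fintype.sum_prod_type_right, Fin.sum_univ_two,
    he, imForm_apply_eq_sum hT, ← Complex.normSq_eq_norm_sq, Complex.normSq_apply,
    Complex.coe_basisOneI_repr, Matrix.cons_val_zero, Matrix.cons_val_one, smul_eq_mul, mul_add]

theorem signature_imForm (hT : ∀ j, T (b j) = d j • b j) (c : ℂ) :
    signature (imForm c (T.restrictScalars ℝ)) = 2 * ∑ j, (SignType.sign (c * d j).im : ℝ) := by
  obtain ⟨e, -⟩ := exists_isometryEquiv_imForm hT c
  rw [signature_eq_of_equivalent ⟨e⟩, signature_weightedSumSquares, Fintype.sum_prod_type,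
    Fin.sum_univ_two, two_mul]

theorem radical_imForm (hT : ∀ j, T (b j) = d j • b j) {c : ℂ}
    (hc : ∀ j, (c * d j).im = 0 ↔ d j = 0) :
    (imForm c (T.restrictScalars ℝ)).radical
      = LinearMap.ker (T.restrictScalars ℝ).toLinearMap := by
  obtain ⟨e, he⟩ := exists_isometryEquiv_imForm hT c
  have inner_eq_zero_iff (v : E) (j : ι) :
      inner ℂ (b j) v = 0 ↔ e v (0, j) = 0 ∧ e v (1, j) = 0 := by
    simp [he, Complex.ext_iff]
  ext v
  have hv : v ∈ (imForm c (T.restrictScalars ℝ)).radical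
      ↔ e v ∈ (QuadraticMap.weightedSumSquares ℝ fun x : Fin 2 × ι => (c * d x.2).im).radical := by
    rw [← e.map_radical]
    exact (Function.Injective.mem_set_image e.injective).symm
  rw [hv, QuadraticForm.radical_weightedSumSquares, Pi.mem_spanSubset_iff]
  change _ ↔ T v = 0
  simp only [apply_eq_zero_iff_of_eigenbasis hT, inner_eq_zero_iff, Prod.forall, Fin.forall_fin_two,
    Set.mem_ofPred_eq, hc, or_iff_not_imp_left]
  exact ⟨fun h j hj => ⟨h.1 j hj, h.2 j hj⟩, fun h =>
    ⟨fun j hj => (h j hj).1, fun j hj => (h j hj).2⟩⟩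

end Diagonal

/-! ### Angles of the eigenvalues of a unitary operator -/

section Angles

open Filter Topology

theorem exp_apply_of_apply_eq_smul {E : Type*} [NormedAddCommGroup E] [NormedSpace ℂ E]
    [CompleteSpace E] {T : E →L[ℂ] E} {v : E} {z : ℂ} (hv : T v = z • v) :
    NormedSpace.exp T v = Complex.exp z • v := by
  have pow_apply (k : ℕ) : (T ^ k) v = z ^ k • v := by
    induction k with
    | zero => simp
    | succ k ih => rw [pow_succ, mul_apply_eq_comp, hv, map_smul, ih, smul_smul, pow_succ']
  have hT := (NormedSpace.exp_series_hasSum_exp' (𝕂 := ℂ) T).mapL (ContinuousLinearMap.apply ℂ E v)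
  have hz := (NormedSpace.exp_series_hasSum_exp' (𝕂 := ℂ) z).smul_const v
  rw [← Complex.exp_eq_exp_ℂ] at hz
  refine hT.unique ?_
  simpa [pow_apply, smul_smul] using hz

variable {E : Type*} [NormedAddCommGroup E] [InnerProductSpace ℂ E] [CompleteSpace E]
  [FiniteDimensional ℂ E]

theorem exists_eigenbasis_of_norm_sub_one_lt {U : unitary (E →L[ℂ] E)}
    (hU : ‖(U - 1 : E →L[ℂ] E)‖ < 2) :
    ∃ (b : OrthonormalBasis (Fin (Module.finrank ℂ E)) ℂ E) (θ : Fin (Module.finrank ℂ E) → ℝ),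
      (∀ j, |θ j| < Real.pi) ∧ (∀ j, (U : E →L[ℂ] E) (b j) = Complex.exp (θ j * Complex.I) • b j) ∧
      ∑ j, θ j = (LinearMap.trace ℂ E
        (Unitary.argSelfAdjoint U : E →L[ℂ] E).toLinearMap).re := by
  set S := Unitary.argSelfAdjoint U with hS
  have hsymm : (S : E →L[ℂ] E).toLinearMap.IsSymmetric :=
    ContinuousLinearMap.isSelfAdjoint_iff_isSymmetric.mp S.2
  have hnorm : ‖(S : E →L[ℂ] E)‖ < Real.pi := by
    change ‖S‖ < _
    rw [hS, Unitary.norm_argSelfAdjoint hU, Real.arccos_lt_pi]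
    nlinarith [norm_nonneg (U - 1 : E →L[ℂ] E)]
  set b := hsymm.eigenvectorBasis rfl
  set θ := hsymm.eigenvalues rfl
  have apply_basis (j) : (S : E →L[ℂ] E) (b j) = (θ j : ℂ) • b j :=
    hsymm.apply_eigenvectorBasis rfl j
  refine ⟨b, θ, fun j => ?_, fun j => ?_, ?_⟩
  · have h := (S : E →L[ℂ] E).le_opNorm (b j)
    rw [apply_basis, norm_smul, b.norm_eq_one, mul_one, mul_one, Complex.norm_real] at h
    exact h.trans_lt hnorm
  · rw [← expUnitary_argSelfAdjoint hU, selfAdjoint.expUnitary_coe]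
    refine exp_apply_of_apply_eq_smul ?_
    rw [smul_apply, ← hS, apply_basis, smul_smul, mul_comm]
  · rw [hsymm.trace_eq_sum_eigenvalues rfl]
    exact (Complex.ofReal_re _).symm

theorem exp_mul_I_mem_unitary (α : ℝ) : Complex.exp (α * Complex.I) ∈ unitary ℂ := by
  have h : Complex.exp (α * Complex.I) * star (Complex.exp (α * Complex.I)) = 1 := by
    rw [Complex.star_def, Complex.mul_conj', Complex.norm_exp_ofReal_mul_I, Complex.ofReal_one,
      one_pow]
  exact Unitary.mem_iff.mpr ⟨(mul_comm _ _).trans h, h⟩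

theorem exists_norm_exp_smul_sub_one_lt {U : E →L[ℂ] E} (hU : U ∈ unitary (E →L[ℂ] E)) :
    ∃ α : ℝ, |α| < Real.pi ∧ ‖Complex.exp ((-α : ℝ) * Complex.I) • U - 1‖ < 2 := by
  have injOn : Set.InjOn (fun α : ℝ => -Complex.exp (α * Complex.I)) (Set.Ioo (-Real.pi) Real.pi) :=
    Set.LeftInvOn.injOn (f₁' := fun z => Complex.arg (-z)) fun α hα => by
      simp only [neg_neg, Complex.arg_exp_mul_I]
      exact (toIocMod_eq_self _).mpr ⟨hα.1, by linarith [hα.2]⟩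
  have hfin : (spectrum ℂ U).Finite := by
    rw [ContinuousLinearMap.spectrum_eq]
    exact Module.End.finite_spectrum U.toLinearMap
  obtain ⟨-, ⟨α, hα, rfl⟩, hspec⟩ :=
    ((Set.Ioo_infinite (neg_lt_self Real.pi_pos)).image injOn).exists_notMem_finite hfin
  refine ⟨α, abs_lt.mpr hα, ?_⟩
  rw [Unitary.norm_sub_one_lt_two_iff (Unitary.smul_mem_of_mem (exp_mul_I_mem_unitary _) hU)]
  have h := (spectrum.smul_mem_smul_iff
    (r := Units.mk0 (Complex.exp ((-α : ℝ) * Complex.I)) (Complex.exp_ne_zero _))).not.mpr hspec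
  simpa [Units.smul_def, ← Complex.exp_add] using h

theorem eventually_exists_eigenbasis_near (U : unitary (E →L[ℂ] E)) :
    ∃ α : ℝ, |α| < Real.pi ∧ ∃ S : unitary (E →L[ℂ] E) → ℝ, ContinuousAt S U ∧
      ∀ᶠ V : unitary (E →L[ℂ] E) in 𝓝 U, ∃ (b : OrthonormalBasis (Fin (Module.finrank ℂ E)) ℂ E)
          (θ : Fin (Module.finrank ℂ E) → ℝ), (∀ j, |θ j - α| < Real.pi) ∧
        (∀ j, (V : E →L[ℂ] E) (b j) = Complex.exp (θ j * Complex.I) • b j) ∧ ∑ j, θ j = S V := by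
  obtain ⟨α, hα, hU⟩ := exists_norm_exp_smul_sub_one_lt U.2
  let rot (V : unitary (E →L[ℂ] E)) : unitary (E →L[ℂ] E) :=
    (⟨_, exp_mul_I_mem_unitary (-α)⟩ : unitary ℂ) • V
  have rot_coe (V) : (rot V : E →L[ℂ] E) = Complex.exp ((-α : ℝ) * Complex.I) • (V : E →L[ℂ] E) :=
    rfl
  have continuous_rot : Continuous rot :=
    Continuous.subtype_mk (continuous_subtype_val.const_smul _) _
  have mem_ball (V) : rot V ∈ Metric.ball (1 : unitary (E →L[ℂ] E)) 2
      ↔ ‖(rot V : E →L[ℂ] E) - 1‖ < 2 := by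
    rw [Metric.mem_ball, Subtype.dist_eq, dist_eq_norm, OneMemClass.coe_one]
  refine ⟨α, hα, fun V => (LinearMap.trace ℂ E
    (Unitary.argSelfAdjoint (rot V) : E →L[ℂ] E).toLinearMap).re + Module.finrank ℂ E * α, ?_, ?_⟩
  · have hcoe : ContinuousAt
        (fun V => (Unitary.argSelfAdjoint (rot V) : E →L[ℂ] E)) U :=
      continuous_subtype_val.continuousAt.comp ((Unitary.continuousOn_argSelfAdjoint.continuousAt
        (Metric.isOpen_ball.mem_nhds ((mem_ball U).mpr hU))).comp continuous_rot.continuousAt)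
    have htrace : Continuous (LinearMap.trace ℂ E ∘ₗ ContinuousLinearMap.coeLM ℂ) :=
      LinearMap.continuous_of_finiteDimensional _
    exact (Complex.continuous_re.continuousAt.comp
      (htrace.continuousAt.comp hcoe)).add continuousAt_const
  · have hball := continuous_rot.continuousAt.eventually
      (Metric.isOpen_ball.mem_nhds ((mem_ball U).mpr hU))
    filter_upwards [hball] with V hV
    obtain ⟨b, θ, hθ, hb, hsum⟩ := exists_eigenbasis_of_norm_sub_one_lt ((mem_ball V).mp hV)
    refine ⟨b, fun j => θ j + α, fun j => by simpa using hθ j, fun j => ?_, by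
      simp [Finset.sum_add_distrib, hsum]⟩
    have h := congrArg (Complex.exp (α * Complex.I) • ·) (hb j)
    simp only [rot_coe, smul_apply, smul_smul, ← Complex.exp_add] at h
    simpa [← add_mul, add_comm] using h

theorem exists_eventually_eq_intCast {X : Type*} [TopologicalSpace X] {f : X → ℝ} {x : X}
    (hf : ContinuousAt f x) (hint : ∀ᶠ y in 𝓝 x, ∃ k : ℤ, f y = k) :
    ∃ N : ℤ, ∀ᶠ y in 𝓝 x, f y = N := by
  obtain ⟨N, hN⟩ := hint.self_of_nhds
  refine ⟨N, ?_⟩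
  filter_upwards [hint, hf.eventually (Metric.ball_mem_nhds _ one_pos)] with y ⟨k, hk⟩ hy
  rw [hN, hk, Real.dist_eq] at hy
  have hkN : |k - N| < 1 := by exact_mod_cast hy
  rw [hk, sub_eq_zero.mp (Int.abs_lt_one_iff.mp hkN)]

theorem eventually_exists_eigenbasis {X : Type*} [TopologicalSpace X] {s : Set X}
    {A : X → E →L[ℂ] E} {φ : X → ℝ} (hU : ∀ y ∈ s, A y ∈ unitary (E →L[ℂ] E))
    (hA : ContinuousOn A s) (hφ : ContinuousOn φ s)
    (hdet : ∀ y ∈ s, (A y).det = Complex.exp (2 * Real.pi * Complex.I * φ y)) {x : X} (hx : x ∈ s) :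
    ∃ α : ℝ, |α| < Real.pi ∧ ∃ N : ℤ, ∀ᶠ y in 𝓝[s] x,
      ∃ (b : OrthonormalBasis (Fin (Module.finrank ℂ E)) ℂ E) (θ : Fin (Module.finrank ℂ E) → ℝ),
        (∀ j, |θ j - α| < Real.pi) ∧
        (∀ j, A y (b j) = Complex.exp (θ j * Complex.I) • b j) ∧
        ∑ j, θ j = 2 * Real.pi * (φ y + N) := by
  let B (y : s) : unitary (E →L[ℂ] E) := ⟨A y, hU y y.2⟩
  have hB : Continuous B := hA.domRestrict.subtype_mk _
  obtain ⟨α, hα, S, hS, hbasis⟩ := eventually_exists_eigenbasis_near (B ⟨x, hx⟩)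
  have hbasisB := hB.continuousAt.eventually hbasis
  obtain ⟨N, hN⟩ := exists_eventually_eq_intCast (f := fun y => S (B y) / (2 * Real.pi) - φ y)
    (((ContinuousAt.comp (f := B) hS hB.continuousAt).div_const _).sub
      hφ.domRestrict.continuousAt) <| by
      filter_upwards [hbasisB] with y ⟨b, θ, _, hb, hsum⟩
      have hexp := hdet y y.2
      rw [det_of_eigenbasis hb, ← Complex.exp_sum, Complex.exp_eq_exp_iff_exists_int] at hexp
      obtain ⟨k, hk⟩ := hexp
      refine ⟨k, ?_⟩
      rw [← Finset.sum_mul, ← Complex.ofReal_sum, hsum] at hk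
      have him : S (B y) = 2 * Real.pi * φ y + k * (2 * Real.pi) := by
        simpa using congrArg Complex.im hk
      rw [him]
      field_simp
      ring
  refine ⟨α, hα, N, (eventually_nhds_subtype_iff s ⟨x, hx⟩ _).mp ?_⟩
  filter_upwards [hbasisB, hN] with y ⟨b, θ, hθ, hb, hsum⟩ hy
  refine ⟨b, θ, hθ, hb, ?_⟩
  rw [hsum, ← hy]
  field_simp
  ring

end Angles

/-! ### The index of a unitary path -/

section UnitaryPath

open Filter Set Topology

section Operator

variable {E : Type*} [NormedAddCommGroup E] [InnerProductSpace ℂ E] [NormedSpace ℝ E]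

theorem re_inner_derivWithin_eq_zero {Ψ : ℝ → E →L[ℝ] E} {D : E →L[ℝ] E} {s : Set ℝ} {t : ℝ}
    (hΨ : ∀ x ∈ s, ∀ v, ‖Ψ x v‖ = ‖v‖) (ht : t ∈ s) (hs : UniqueDiffWithinAt ℝ s t)
    (hD : HasDerivWithinAt Ψ D s t) {v : E} (hv : Ψ t v = v) : (inner ℂ v (D v)).re = 0 := by
  have hderiv : HasDerivWithinAt (fun x => Ψ x v) (D v) s t := by
    simpa using hD.clm_apply (hasDerivWithinAt_const t s v)
  have hconst : HasDerivWithinAt (fun x => inner ℂ (Ψ x v) (Ψ x v)) 0 s t :=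
    (hasDerivWithinAt_const t s (inner ℂ v v)).congr_of_mem (fun x hx => by
      rw [inner_self_eq_norm_sq_to_K, inner_self_eq_norm_sq_to_K, hΨ x hx]) ht
  have h := congrArg Complex.re (hs.eq_deriv _ (hderiv.inner ℂ hderiv) hconst)
  rw [hv, Complex.add_re, ← inner_conj_symm (D v) v, Complex.conj_re, Complex.zero_re] at h
  linarith

variable [IsScalarTower ℝ ℂ E]

theorem restrictScalars_sub_one (T : E →L[ℂ] E) :
    (T - 1).restrictScalars ℝ = T.restrictScalars ℝ - 1 := rfl

theorem spectralSum_defect_of_eigenbasis [FiniteDimensional ℂ E] {ι : Type*} [Fintype ι]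
    {b : OrthonormalBasis ι ℂ E} {T : E →L[ℂ] E} {θ : ι → ℝ} {α : ℝ}
    (hα : |α| < Real.pi) (hθ : ∀ j, |θ j - α| < Real.pi)
    (hT : ∀ j, T (b j) = Complex.exp (θ j * Complex.I) • b j) :
    spectralSum defect T = signature (imForm (Complex.exp (-(α / 2) * Complex.I))
      (T.restrictScalars ℝ - 1)) / 2 - (∑ j, θ j) / Real.pi := by
  have hT_sub (j) : (T - 1) (b j) = (Complex.exp (θ j * Complex.I) - 1) • b j := by
    rw [sub_apply, hT, sub_smul, one_smul]; rfl
  have hdefect (j) : defect (Complex.exp (θ j * Complex.I))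
      = SignType.sign (θ j) - θ j / Real.pi := by
    refine defect_exp_eq_sign_sub ?_
    have h := abs_add_le (θ j - α) α
    rw [sub_add_cancel] at h
    linarith [hθ j]
  have hsignature := signature_imForm hT_sub (Complex.exp (-(α / 2) * Complex.I))
  rw [restrictScalars_sub_one] at hsignature
  rw [spectralSum_of_eigenbasis hT, hsignature, mul_div_cancel_left₀ _ two_ne_zero]
  simp only [hdefect, sign_im_exp_mul_exp_sub_one hα (hθ _), Finset.sum_sub_distrib,
    Finset.sum_div]

theorem radical_imForm_sub_one {ι : Type*} [Fintype ι] {b : OrthonormalBasis ι ℂ E}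
    {T : E →L[ℂ] E} {θ : ι → ℝ} {α : ℝ} (hα : |α| < Real.pi) (hθ : ∀ j, |θ j - α| < Real.pi)
    (hT : ∀ j, T (b j) = Complex.exp (θ j * Complex.I) • b j) :
    (imForm (Complex.exp (-(α / 2) * Complex.I)) (T.restrictScalars ℝ - 1)).radical
      = LinearMap.ker (T.restrictScalars ℝ - 1).toLinearMap := by
  rw [← restrictScalars_sub_one]
  refine radical_imForm (b := b) (d := fun j => Complex.exp (θ j * Complex.I) - 1) (fun j => ?_)
    fun j => ?_
  · rw [sub_apply, hT, sub_smul, one_smul]; rfl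
  · refine ⟨fun h => ?_, fun h => by rw [h, mul_zero, Complex.zero_im]⟩
    have hsign := sign_im_exp_mul_exp_sub_one hα (hθ j)
    rw [h, sign_zero, eq_comm, sign_eq_zero_iff] at hsign
    simp [hsign]

theorem eventually_abs_imForm_sub_le {Ψ : ℝ → E →L[ℝ] E} {D : E →L[ℝ] E} {s : Set ℝ} {u : ℝ}
    (hD : HasDerivWithinAt Ψ D s u) (c : ℂ) {ε : ℝ} (hε : 0 < ε) :
    ∀ᶠ t in 𝓝[s] u, ∀ v, |imForm c (Ψ t) v - imForm c (Ψ u) v - (t - u) * imForm c D v|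
      ≤ ε * (|t - u| * ‖v‖ ^ 2) := by
  have hc : 0 < ‖c‖ + 1 := by positivity
  filter_upwards [hD.isLittleO.def (div_pos hε hc)] with t ht v
  rw [Real.norm_eq_abs] at ht
  calc |imForm c (Ψ t) v - imForm c (Ψ u) v - (t - u) * imForm c D v|
      = |imForm c (Ψ t - Ψ u - (t - u) • D) v| := by rw [imForm_sub_sub_smul_apply]
    _ ≤ ‖c‖ * ‖Ψ t - Ψ u - (t - u) • D‖ * ‖v‖ ^ 2 := abs_imForm_le _ _ _
    _ ≤ (‖c‖ + 1) * (ε / (‖c‖ + 1) * |t - u|) * ‖v‖ ^ 2 := by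
      gcongr
      exact le_add_of_nonneg_right zero_le_one
    _ = ε * (|t - u| * ‖v‖ ^ 2) := by field_simp

end Operator

variable {m : ℕ} {a b : ℝ}

theorem imForm_restrict_ker
    {Ψ : ℝ → EuclideanSpace ℂ (Fin m) →L[ℝ] EuclideanSpace ℂ (Fin m)} (hab : a < b)
    (hΨ : ∀ t ∈ Icc a b, ∀ v, ‖Ψ t v‖ = ‖v‖) (hdiff : DifferentiableOn ℝ Ψ (Icc a b))
    {t : ℝ} (ht : t ∈ Icc a b) (c : ℂ) :
    (imForm c (derivWithin Ψ (Icc a b) t)).restrict (LinearMap.ker (Ψ t - 1).toLinearMap)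
      = c.re • crossingForm Ψ a b t := by
  ext ⟨v, hv⟩
  have hfix : Ψ t v = v := sub_eq_zero.mp hv
  have hre := re_inner_derivWithin_eq_zero hΨ ht (uniqueDiffOn_Icc hab t ht)
    (hdiff t ht).hasDerivWithinAt hfix
  change (c * inner ℂ v (derivWithin Ψ (Icc a b) t v)).im
    = c.re * (inner ℂ v (derivWithin Ψ (Icc a b) t v)).im
  rw [Complex.mul_im, hre, mul_zero, add_zero]

theorem eventually_signature_imForm_eq
    {Ψ : ℝ → EuclideanSpace ℂ (Fin m) →L[ℝ] EuclideanSpace ℂ (Fin m)} (hab : a < b)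
    (hΨ : ∀ t ∈ Icc a b, ∀ v, ‖Ψ t v‖ = ‖v‖) (hreg : IsRegularPath Ψ a b) {u : ℝ}
    (hu : u ∈ Icc a b) {c : ℂ} (hc : 0 < c.re)
    (hradical : (imForm c (Ψ u - 1)).radical = LinearMap.ker (Ψ u - 1).toLinearMap) :
    ∀ᶠ t in 𝓝[Icc a b] u, signature (imForm c (Ψ t - 1))
      = signature (imForm c (Ψ u - 1)) + SignType.sign (t - u) * crossingSignature Ψ a b u := by
  have hdiff : DifferentiableOn ℝ Ψ (Icc a b) := hreg.contDiffOn.differentiableOn one_ne_zero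
  have hrestrict := imForm_restrict_ker hab hΨ hdiff hu c
  have hjump := eventually_signature_eq (q := fun t => imForm c (Ψ t - 1))
    (r := imForm c (derivWithin Ψ (Icc a b) u))
    (by rw [hradical, hrestrict, radical_smul hc.ne', hreg.regular u hu])
    fun ε hε => eventually_abs_imForm_sub_le ((hdiff u hu).hasDerivWithinAt.sub_const 1) c hε
  rwa [hradical, hrestrict, signature_smul hc] at hjump

variable {A : ℝ → EuclideanSpace ℂ (Fin m) →L[ℂ] EuclideanSpace ℂ (Fin m)} {φ : ℝ → ℝ}

theorem eventually_spectralSum_defect_eq (hab : a < b) (hA : ∀ t ∈ Icc a b, A t ∈ unitary _)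
    (hreg : IsRegularPath (fun t => (A t).restrictScalars ℝ) a b) (hφ : ContinuousOn φ (Icc a b))
    (hdet : ∀ t ∈ Icc a b, (A t).det = Complex.exp (2 * Real.pi * Complex.I * φ t))
    {u : ℝ} (hu : u ∈ Icc a b) :
    ∀ᶠ t in 𝓝[Icc a b] u, 2 * (spectralSum defect (A t) + 2 * φ t)
      = 2 * (spectralSum defect (A u) + 2 * φ u)
        + SignType.sign (t - u) * crossingSignature (fun t => (A t).restrictScalars ℝ) a b u := by
  have isInducing := (ContinuousLinearMap.restrictScalarsIsometry ℂ (EuclideanSpace ℂ (Fin m))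
    (EuclideanSpace ℂ (Fin m)) ℝ ℝ).isometry.isEmbedding.isInducing
  obtain ⟨α, hα, N, hbasis⟩ := eventually_exists_eigenbasis hA
    (isInducing.continuousOn_iff.mpr hreg.contDiffOn.continuousOn) hφ hdet hu
  have hsignature : ∀ᶠ t in 𝓝[Icc a b] u, 2 * (spectralSum defect (A t) + 2 * φ t)
      = signature (imForm (Complex.exp (-(α / 2) * Complex.I)) ((A t).restrictScalars ℝ - 1))
        - 4 * N := by
    filter_upwards [hbasis] with t ⟨b, θ, hθ, hb, hsum⟩
    rw [spectralSum_defect_of_eigenbasis hα hθ hb, hsum]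
    field_simp
    ring
  have exp_re_pos : 0 < (Complex.exp (-(α / 2) * Complex.I)).re := by
    obtain ⟨hα₁, hα₂⟩ := abs_lt.mp hα
    rw [← Complex.ofReal_ofNat, ← Complex.ofReal_div, ← Complex.ofReal_neg,
      Complex.exp_ofReal_mul_I_re]
    exact Real.cos_pos_of_mem_Ioo ⟨by linarith, by linarith⟩
  obtain ⟨b₀, θ, hθ, hb₀, -⟩ := hbasis.self_of_nhdsWithin hu
  have hradical := radical_imForm_sub_one hα hθ hb₀
  have hjump := eventually_signature_imForm_eq (Ψ := fun t => (A t).restrictScalars ℝ) hab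
    (fun t ht v => (A t).norm_map_of_mem_unitary (hA t ht) v) hreg hu exp_re_pos hradical
  filter_upwards [hsignature, hjump] with t ht htu
  rw [ht, htu, hsignature.self_of_nhdsWithin hu, add_sub_right_comm]

theorem index_eq_sub (hab : a < b) (hA : ∀ t ∈ Icc a b, A t ∈ unitary _)
    (hreg : IsRegularPath (fun t => (A t).restrictScalars ℝ) a b) (hφ : ContinuousOn φ (Icc a b))
    (hdet : ∀ t ∈ Icc a b, (A t).det = Complex.exp (2 * Real.pi * Complex.I * φ t)) :
    index (fun t => (A t).restrictScalars ℝ) a b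
      = spectralSum defect (A b) + 2 * φ b - (spectralSum defect (A a) + 2 * φ a) := by
  have h := sub_eq_sum_jumps hab fun u hu =>
    eventually_spectralSum_defect_eq hab hA hreg hφ hdet hu
  rw [index]
  linarith

end UnitaryPath

section Matrix

variable {ι : Type*} [Fintype ι] [DecidableEq ι]

theorem det_toEuclideanCLM (A : Matrix ι ι ℂ) :
    (Matrix.toEuclideanCLM (𝕜 := ℂ) A).det = A.det := by
  rw [ContinuousLinearMap.det, Matrix.coe_toEuclideanCLM_eq_toEuclideanLin,
    Matrix.toEuclideanLin_eq_toLin_orthonormal, LinearMap.det_toLin]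

theorem spectralSum_toEuclideanCLM (r : ℂ → ℝ) (A : Matrix ι ι ℂ) :
    spectralSum r (Matrix.toEuclideanCLM (𝕜 := ℂ) A) = (A.charpoly.roots.map r).sum := by
  rw [spectralSum, Matrix.coe_toEuclideanCLM_eq_toEuclideanLin,
    Matrix.toEuclideanLin_eq_toLin_orthonormal, Matrix.charpoly_toLin]

theorem spectralSum_toEuclideanCLM_diagonal (r : ℂ → ℝ) (d : ι → ℂ) :
    spectralSum r (Matrix.toEuclideanCLM (𝕜 := ℂ) (Matrix.diagonal d)) = ∑ i, r (d i) := by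
  refine spectralSum_of_eigenbasis (b := EuclideanSpace.basisFun ι ℂ) (fun j => ?_) r
  ext i
  by_cases hij : i = j <;> simp [Matrix.mulVec_diagonal, hij]

end Matrix

/-! ### Exponential and diagonal paths -/

theorem contDiff_exp_two_pi_mul (b : ℝ) :
    ContDiff ℝ 1 fun t : ℝ => Complex.exp (2 * Real.pi * Complex.I * ((t * b : ℝ) : ℂ)) := by
  have contDiff_ofReal : ContDiff ℝ 1 fun t : ℝ => ((t * b : ℝ) : ℂ) :=
    Complex.ofRealCLM.contDiff.comp (contDiff_id.mul contDiff_const)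
  exact (contDiff_const.mul contDiff_ofReal).cexp

theorem hasDerivAt_exp_two_pi_mul (b t : ℝ) :
    HasDerivAt (fun t : ℝ => Complex.exp (2 * Real.pi * Complex.I * ((t * b : ℝ) : ℂ)))
      (2 * Real.pi * b * Complex.I *
        Complex.exp (2 * Real.pi * Complex.I * ((t * b : ℝ) : ℂ))) t := by
  have hasDerivAt_exponent :
      HasDerivAt (fun t : ℝ => 2 * Real.pi * Complex.I * ((t * b : ℝ) : ℂ))
        (2 * Real.pi * Complex.I * b) t := by
    simpa using ((hasDerivAt_id t).mul_const b).ofReal_comp.const_mul (2 * Real.pi * Complex.I)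
  exact hasDerivAt_exponent.cexp.congr_deriv (by ring)

theorem isRotationNumber_exp_mul {c : ℝ → ℂ} {c₀ : ℂ} {a b β : ℝ} (hc₀ : c₀ ≠ 0)
    (hc : ∀ t ∈ Set.Icc a b,
      c t = Complex.exp (2 * Real.pi * Complex.I * ((t * β : ℝ) : ℂ)) * c₀) :
    IsRotationNumber c a b ((b - a) * β) := by
  refine ⟨fun t => t * β + c₀.arg / (2 * Real.pi), by fun_prop, fun t ht => ?_, by ring⟩
  rw [hc t ht, norm_mul, norm_exp_two_pi_mul, one_mul]
  refine ⟨mul_ne_zero (Complex.exp_ne_zero _) hc₀, ?_⟩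
  have exponent_eq : 2 * Real.pi * Complex.I * ((t * β + c₀.arg / (2 * Real.pi) : ℝ) : ℂ) =
      2 * Real.pi * Complex.I * ((t * β : ℝ) : ℂ) + c₀.arg * Complex.I := by
    push_cast
    field_simp
  rw [exponent_eq, Complex.exp_add, mul_left_comm, Complex.norm_mul_exp_arg_mul_I]

section DiagonalPath

open Matrix

variable {m : ℕ}

/-- The diagonal endomorphism of `ℂᵐ = ℝ²ᵐ` with complex diagonal entries `d`, as a continuous
linear function of `d`; it is used to differentiate paths of diagonal endomorphisms. -/
def diagonalEnd (m : ℕ) :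
    (Fin m → ℂ) →L[ℝ] EuclideanSpace ℂ (Fin m) →L[ℝ] EuclideanSpace ℂ (Fin m) :=
  LinearMap.toContinuousLinearMap
    (ContinuousLinearMap.restrictScalarsₗ ℂ _ _ ℝ ℝ ∘ₗ
      ((toEuclideanCLM (n := Fin m) (𝕜 := ℂ)).toAlgEquiv.toLinearMap ∘ₗ
        diagonalLinearMap (Fin m) ℂ ℂ).restrictScalars ℝ)

theorem diagonalEnd_apply (d : Fin m → ℂ) :
    diagonalEnd m d = (toEuclideanCLM (𝕜 := ℂ) (diagonal d)).restrictScalars ℝ :=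
  rfl

theorem diagonalEnd_apply_apply (d : Fin m → ℂ) (v : EuclideanSpace ℂ (Fin m)) (i : Fin m) :
    diagonalEnd m d v i = d i * v i :=
  mulVec_diagonal d v.ofLp i

theorem isSymplectic_diagonalEnd {d : Fin m → ℂ} (hd : ∀ j, ‖d j‖ = 1) :
    IsSymplectic (diagonalEnd m d) := by
  intro u v
  refine congrArg Complex.im ?_
  rw [PiLp.inner_apply, PiLp.inner_apply]
  refine Finset.sum_congr rfl fun j _ => ?_
  have mul_conj_self : d j * (starRingEnd ℂ) (d j) = 1 := by
    rw [Complex.mul_conj', hd, Complex.ofReal_one, one_pow]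
  rw [diagonalEnd_apply_apply, diagonalEnd_apply_apply, RCLike.inner_apply, RCLike.inner_apply,
    map_mul, mul_mul_mul_comm, mul_conj_self, one_mul]

theorem omega_diagonalEnd {d : Fin m → ℂ} {s : Fin m → ℝ} {v : EuclideanSpace ℂ (Fin m)}
    (hv : diagonalEnd m d v = v) :
    omega m v (diagonalEnd m (fun j => s j * Complex.I * d j) v) = ∑ j, s j * ‖v j‖ ^ 2 := by
  have inner_eq : inner ℂ v (diagonalEnd m (fun j => s j * Complex.I * d j) v) =
      ((∑ j, s j * ‖v j‖ ^ 2 : ℝ) : ℂ) * Complex.I := by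
    rw [PiLp.inner_apply, Complex.ofReal_sum, Finset.sum_mul]
    refine Finset.sum_congr rfl fun j _ => ?_
    rw [diagonalEnd_apply_apply, mul_assoc, ← diagonalEnd_apply_apply, hv, RCLike.inner_apply]
    push_cast
    rw [← Complex.conj_mul']
    ring
  change (inner ℂ v _).im = _
  rw [inner_eq, Complex.im_ofReal_mul, Complex.I_im, mul_one]

theorem isRegularPath_diagonalEnd {s : Fin m → ℝ} (hs : ∀ j, 0 < s j) {a b : ℝ} (hab : a < b) :
    IsRegularPath (fun t => diagonalEnd m fun j =>
      Complex.exp (2 * Real.pi * Complex.I * ((t * s j : ℝ) : ℂ))) a b where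
  contDiffOn := ((diagonalEnd m).contDiff.comp
    (contDiff_pi.mpr fun j => contDiff_exp_two_pi_mul (s j))).contDiffOn
  symplectic _ _ := isSymplectic_diagonalEnd fun _ => norm_exp_two_pi_mul _
  regular t ht := by
    rw [eq_bot_iff]
    rintro ⟨v, hv⟩ hrad
    have hasDerivAt := (diagonalEnd m).hasFDerivAt.comp_hasDerivAt t
      (hasDerivAt_pi.mpr fun j => hasDerivAt_exp_two_pi_mul (s j) t)
    have crossingForm_eq_zero := (QuadraticMap.mem_radical_iff'.mp hrad).1
    change omega m v (derivWithin (diagonalEnd m ∘ _) (Set.Icc a b) t v) = 0 at crossingForm_eq_zero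
    rw [hasDerivAt.hasDerivWithinAt.derivWithin (uniqueDiffOn_Icc hab t ht)]
      at crossingForm_eq_zero
    have sum_eq_zero : ∑ j, 2 * Real.pi * s j * ‖v j‖ ^ 2 = 0 := by
      rw [← omega_diagonalEnd (sub_eq_zero.mp hv), ← crossingForm_eq_zero]
      push_cast
      rfl
    have speed_pos (j : Fin m) : 0 < 2 * Real.pi * s j := mul_pos Real.two_pi_pos (hs j)
    rw [Finset.sum_eq_zero_iff_of_nonneg fun j _ =>
      mul_nonneg (speed_pos j).le (sq_nonneg _)] at sum_eq_zero
    refine Subtype.ext (PiLp.ext fun j => norm_eq_zero.mp (pow_eq_zero_iff two_ne_zero |>.mp ?_))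
    exact (mul_eq_zero.mp (sum_eq_zero j (Finset.mem_univ j))).resolve_left (speed_pos j).ne'

end DiagonalPath

theorem exists_eigenbasis_of_mem_unitary {E : Type*} [NormedAddCommGroup E]
    [InnerProductSpace ℂ E] [CompleteSpace E] [FiniteDimensional ℂ E] {m : ℕ}
    (hm : Module.finrank ℂ E = m) {U : E →L[ℂ] E} (hU : U ∈ unitary (E →L[ℂ] E)) :
    ∃ (b : OrthonormalBasis (Fin m) ℂ E) (s : Fin m → ℝ), (∀ j, 0 < s j) ∧
      ∀ j, U (b j) = Complex.exp (2 * Real.pi * Complex.I * s j) • b j := by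
  subst hm
  obtain ⟨α, hα, S, _, eigenbasis_near⟩ := eventually_exists_eigenbasis_near ⟨U, hU⟩
  obtain ⟨b, θ, hθ, hb, _⟩ := eigenbasis_near.self_of_nhds
  refine ⟨b, fun j => θ j / (2 * Real.pi) + 1, fun j => ?_, fun j => ?_⟩
  · have : -1 < θ j / (2 * Real.pi) := by
      rw [lt_div_iff₀ Real.two_pi_pos]
      linarith [abs_lt.mp hα, abs_lt.mp (hθ j)]
    linarith
  · have exponent_eq : 2 * Real.pi * Complex.I * ((θ j / (2 * Real.pi) + 1 : ℝ) : ℂ) =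
        θ j * Complex.I + 2 * Real.pi * Complex.I := by
      push_cast
      field_simp
    rw [exponent_eq, Complex.exp_periodic]
    exact hb j

end RobbinSalamon

namespace LGOrbifold

open MvPolynomial RobbinSalamon

/-! ### Semi-invariance under diagonal maps -/

section Semiinvariant

variable {n : ℕ} {W : MvPolynomial (Fin n) ℂ} {T : Fin n → ℂ} {κ : ℂ}

/-- `W` is semi-invariant under the diagonal map `x ↦ T * x`, i.e. it is multiplied by the
constant `κ`.  The diagonal symmetries (with `κ = 1`) and the Reeb flow are treated uniformly as
diagonal maps of this kind. -/
def IsSemiinvariant (W : MvPolynomial (Fin n) ℂ) (T : Fin n → ℂ) (κ : ℂ) : Prop :=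
  ∀ x, eval (T * x) W = κ * eval x W

/-- The substitution `xᵢ ↦ Tᵢ xᵢ`, which expresses semi-invariance as an identity of polynomials. -/
def rescale (T : Fin n → ℂ) : MvPolynomial (Fin n) ℂ →ₐ[ℂ] MvPolynomial (Fin n) ℂ :=
  bind₁ fun i => C (T i) * X i

theorem eval_rescale (T x : Fin n → ℂ) (P : MvPolynomial (Fin n) ℂ) :
    eval x (rescale T P) = eval (T * x) P := by
  rw [rescale, ← coe_aeval_eq_eval, ← coe_aeval_eq_eval, RingHom.coe_coe, RingHom.coe_coe,
    aeval_bind₁]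
  congr 2
  ext i
  simp

theorem rescale_monomial (T : Fin n → ℂ) (d : Fin n →₀ ℕ) (c : ℂ) :
    rescale T (monomial d c) = monomial d ((∏ i, T i ^ d i) * c) := by
  have prod_univ (f : Fin n → MvPolynomial (Fin n) ℂ) :
      ∏ i ∈ d.support, f i ^ d i = ∏ i, f i ^ d i :=
    Finsupp.prod_fintype d (fun i k => f i ^ k) fun i => pow_zero _
  rw [rescale, bind₁_monomial, monomial_eq, Finsupp.prod, prod_univ, prod_univ]
  simp only [mul_pow, Finset.prod_mul_distrib, map_mul, map_prod, map_pow]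
  ring

theorem coeff_rescale (T : Fin n → ℂ) (P : MvPolynomial (Fin n) ℂ) (d : Fin n →₀ ℕ) :
    coeff d (rescale T P) = (∏ i, T i ^ d i) * coeff d P := by
  induction P using MvPolynomial.induction_on' with
  | monomial e c =>
    rw [rescale_monomial, coeff_monomial, coeff_monomial]
    split_ifs with hed
    · rw [hed]
    · rw [mul_zero]
  | add p q hp hq => rw [map_add, coeff_add, coeff_add, hp, hq, mul_add]

theorem pderiv_rescale (T : Fin n → ℂ) (i : Fin n) (P : MvPolynomial (Fin n) ℂ) :
    pderiv i (rescale T P) = C (T i) * rescale T (pderiv i P) := by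
  ext d
  have prod_pow : ∏ k, T k ^ (d + Finsupp.single i 1 : Fin n →₀ ℕ) k = (∏ k, T k ^ d k) * T i := by
    simp only [Finsupp.add_apply, pow_add, Finset.prod_mul_distrib, Finsupp.single_apply,
      pow_ite, pow_zero, pow_one, Finset.prod_ite_eq, Finset.mem_univ, if_true]
  rw [coeff_pderiv, coeff_rescale, coeff_C_mul, coeff_rescale, coeff_pderiv, prod_pow]
  ring

namespace IsSemiinvariant

theorem rescale_eq (hT : IsSemiinvariant W T κ) : rescale T W = C κ * W :=
  MvPolynomial.funext fun x => by rw [eval_rescale, hT, eval_mul, eval_C]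

theorem prod_pow_eq (hT : IsSemiinvariant W T κ) {d : Fin n →₀ ℕ} (hd : coeff d W ≠ 0) :
    ∏ i, T i ^ d i = κ :=
  mul_right_cancel₀ hd (by rw [← coeff_rescale, hT.rescale_eq, coeff_C_mul])

theorem partialAt_mul (hT : IsSemiinvariant W T κ) (i : Fin n) (x : Fin n → ℂ) :
    partialAt W i (T * x) * T i = κ * partialAt W i x := by
  have h := congrArg (fun P => eval x (pderiv i P)) hT.rescale_eq
  simp only [pderiv_rescale, pderiv_C_mul, eval_mul, eval_C, eval_rescale] at h
  rw [partialAt, mul_comm, h, partialAt]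

theorem exists_partialAt_ne_zero (hT : IsSemiinvariant W T κ) (hκ : κ ≠ 0) {x : Fin n → ℂ}
    (hx : ∃ i, partialAt W i x ≠ 0) : ∃ i, partialAt W i (T * x) ≠ 0 := by
  obtain ⟨i, hi⟩ := hx
  exact ⟨i, fun h => mul_ne_zero hκ hi (by rw [← hT.partialAt_mul, h, zero_mul])⟩

theorem sum_partialAt_mul (hT : IsSemiinvariant W T κ) (x v : Fin n → ℂ) :
    ∑ i, partialAt W i (T * x) * (T * v) i = κ * ∑ i, partialAt W i x * v i := by
  simp only [Finset.mul_sum, Pi.mul_apply, ← mul_assoc, hT.partialAt_mul]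

end IsSemiinvariant

theorem isSemiinvariant_of_mem_symmetryGroup {g : Fin n → ℂˣ} (hg : g ∈ symmetryGroup W) :
    IsSemiinvariant W (fun i => (g i : ℂ)) 1 :=
  fun x => (hg x).trans (one_mul _).symm

theorem isSemiinvariant_pow {w : Fin n → ℕ} {h : ℕ} (hW : IsWeightedHomogeneous w W h) (y : ℂ) :
    IsSemiinvariant W (fun i => y ^ w i) (y ^ h) := by
  intro x
  rw [eval_eq', eval_eq', Finset.mul_sum]
  refine Finset.sum_congr rfl fun d hd => ?_
  have weight_eq : ∑ i, w i * d i = h := by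
    rw [← hW (mem_support_iff.mp hd), Finsupp.weight_apply, Finsupp.sum_fintype _ _ (by simp)]
    exact Finset.sum_congr rfl fun i _ => mul_comm _ _
  simp only [Pi.mul_apply, mul_pow, Finset.prod_mul_distrib, ← pow_mul,
    Finset.prod_pow_eq_pow_sum, weight_eq]
  ring

end Semiinvariant

/-! ### Consequences of non-degeneracy -/

section Nondegenerate

variable {n : ℕ} {W : MvPolynomial (Fin n) ℂ}

theorem coeff_ne_zero_of_partialAt_single_ne_zero {i j : Fin n} {c : ℂ}
    (hc : partialAt W j (Pi.single i c) ≠ 0) :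
    ∃ a : ℕ, coeff (Finsupp.single i a) (pderiv j W) ≠ 0 := by
  rw [partialAt, eval_eq'] at hc
  obtain ⟨d, -, hd⟩ := Finset.exists_ne_zero_of_sum_ne_zero hc
  have d_eq : d = Finsupp.single i (d i) := by
    ext k
    rcases eq_or_ne k i with rfl | hk
    · rw [Finsupp.single_eq_same]
    · have hpow := Finset.prod_ne_zero_iff.mp (right_ne_zero_of_mul hd) k (Finset.mem_univ k)
      rw [Pi.single_eq_of_ne hk] at hpow
      rw [Finsupp.single_eq_of_ne hk]
      exact not_imp_comm.mp zero_pow hpow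
  exact ⟨d i, d_eq ▸ left_ne_zero_of_mul hd⟩

theorem IsNondegenerate.exists_partialAt_comp_ne_zero (hnd : IsNondegenerate W)
    {f : ℂ → Fin n → ℂ} (hf : Continuous f) (hf_zero : f 0 = 0) (hf_ne : ∀ s ≠ 0, f s ≠ 0) :
    ∃ s ≠ 0, ∃ i, partialAt W i (f s) ≠ 0 := by
  have tendsto_punctured : Filter.Tendsto f (nhdsWithin 0 {0}ᶜ) (nhdsWithin 0 {0}ᶜ) :=
    tendsto_nhdsWithin_iff.mpr ⟨(hf.tendsto' 0 0 hf_zero).mono_left nhdsWithin_le_nhds,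
      eventually_mem_nhdsWithin.mono hf_ne⟩
  obtain ⟨s, hs, hs_ne⟩ :=
    ((tendsto_punctured.eventually hnd.isolated).and self_mem_nhdsWithin).exists
  exact ⟨s, hs_ne, hs⟩

theorem IsNondegenerate.exists_monomial (hnd : IsNondegenerate W) (i : Fin n) :
    ∃ (a : ℕ) (j : Fin n), coeff (Finsupp.single i a + Finsupp.single j 1) W ≠ 0 ∧
      1 ≤ a ∧ (2 ≤ a ∨ j = i) := by
  have axis_ne_zero (c : ℂ) (hc : c ≠ 0) : (Pi.single i c : Fin n → ℂ) ≠ 0 :=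
    Pi.single_ne_zero_iff.mpr hc
  obtain ⟨c, -, j, hc⟩ := hnd.exists_partialAt_comp_ne_zero
    (continuous_single (A := fun _ => ℂ) i) (Pi.single_zero i) axis_ne_zero
  obtain ⟨a, ha⟩ := coeff_ne_zero_of_partialAt_single_ne_zero hc
  have ha_ne_zero : a ≠ 0 := by
    rintro rfl
    refine ha ?_
    rw [Finsupp.single_zero, ← constantCoeff_eq, ← eval_zero]
    exact hnd.singular j
  rw [coeff_pderiv] at ha
  refine ⟨a, j, left_ne_zero_of_mul ha, Nat.one_le_iff_ne_zero.mpr ha_ne_zero, ?_⟩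
  by_contra! h
  obtain rfl : a = 1 := by omega
  exact left_ne_zero_of_mul ha (hnd.no_cross_term i j h.2.symm)

/-- The relations `gᵢᵃ gⱼ = 1` given by the monomials force the largest `|log |gᵢ||` to vanish. -/
theorem norm_eq_one_of_mem_symmetryGroup (hnd : IsNondegenerate W) {g : Fin n → ℂˣ}
    (hg : g ∈ symmetryGroup W) (i : Fin n) : ‖(g i : ℂ)‖ = 1 := by
  set u : Fin n → ℝ := fun k => Real.log ‖(g k : ℂ)‖
  obtain ⟨k, -, hk⟩ := Finset.exists_max_image Finset.univ (fun k => |u k|) ⟨i, Finset.mem_univ i⟩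
  obtain ⟨a, j, hcoeff, ha, haj⟩ := hnd.exists_monomial k
  have log_relation : a * u k + u j = 0 := by
    have prod_eq_one := (isSemiinvariant_of_mem_symmetryGroup hg).prod_pow_eq hcoeff
    simp only [Finsupp.add_apply, pow_add, Finset.prod_mul_distrib, Finsupp.single_apply,
      pow_ite, pow_zero, pow_one, Finset.prod_ite_eq, Finset.mem_univ, if_true] at prod_eq_one
    have log_prod_eq := congrArg (fun z : ℂ => Real.log ‖z‖) prod_eq_one
    simpa [Real.log_mul] using log_prod_eq
  have max_eq_zero : |u k| = 0 := by
    rcases haj with ha₂ | rfl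
    · have hj : |a * u k| ≤ |u k| := by
        rw [eq_neg_of_add_eq_zero_left log_relation, abs_neg]
        exact hk j (Finset.mem_univ j)
      rw [abs_mul, Nat.abs_cast] at hj
      have : (2 : ℝ) ≤ a := by exact_mod_cast ha₂
      nlinarith [abs_nonneg (u k)]
    · have : ((a : ℝ) + 1) * u j = 0 := by linarith
      rw [(mul_eq_zero.mp this).resolve_left (by positivity), abs_zero]
  have log_eq_zero : u i = 0 := abs_nonpos_iff.mp (max_eq_zero ▸ hk i (Finset.mem_univ i))
  exact Real.eq_one_of_pos_of_log_eq_zero (norm_pos_iff.mpr (g i).ne_zero) log_eq_zero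

/-- Along `s ↦ (s^{wᵢ} pᵢ)`, `s → 0`, a critical point stays critical and tends to the origin. -/
theorem exists_partialAt_ne_zero {w : Fin n → ℕ} {h : ℕ} (hw : ∀ i, 0 < w i)
    (hW : IsWeightedHomogeneous w W h) (hnd : IsNondegenerate W) {p : Fin n → ℂ} (hp : p ≠ 0) :
    ∃ i, partialAt W i p ≠ 0 := by
  by_contra! hcrit
  have curve_zero : (fun i => (0 : ℂ) ^ w i) * p = 0 := by
    ext i
    simp [(hw i).ne']
  have curve_ne_zero : ∀ s : ℂ, s ≠ 0 → (fun i => s ^ w i) * p ≠ 0 := fun s hs hzero =>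
    hp (funext fun i => (mul_eq_zero.mp (congrFun hzero i)).resolve_left (pow_ne_zero _ hs))
  obtain ⟨s, hs, i, hi⟩ := hnd.exists_partialAt_comp_ne_zero (by fun_prop) curve_zero curve_ne_zero
  have := (isSemiinvariant_pow hW s).partialAt_mul i p
  rw [hcrit i, mul_zero] at this
  exact hi ((mul_eq_zero.mp this).resolve_right (pow_ne_zero _ hs))

end Nondegenerate

/-! ### The Reeb flow and its twist by a symmetry -/

section Flow

variable {n : ℕ} (w : Fin n → ℕ) (h : ℕ)

/-- The eigenvalues of the Reeb flow: `R_t x = flowFactor w h t * x`. -/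
def flowFactor (t : ℝ) : Fin n → ℂ :=
  fun i => Complex.exp (2 * Real.pi * Complex.I * ((t * thetaJ w h i : ℝ) : ℂ))

theorem norm_flowFactor (t : ℝ) (i : Fin n) : ‖flowFactor w h t i‖ = 1 :=
  norm_exp_two_pi_mul _

theorem reebFlow_zero (x : Fin n → ℂ) : reebFlow w h 0 x = x := by
  ext i
  simp [reebFlow]

theorem prod_flowFactor (t : ℝ) : ∏ i, flowFactor w h t i =
    Complex.exp (2 * Real.pi * Complex.I * ((t * ∑ i, thetaJ w h i : ℝ) : ℂ)) := by
  simp only [flowFactor]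
  rw [← Complex.exp_sum, ← Finset.mul_sum, ← Complex.ofReal_sum, ← Finset.mul_sum]

variable {w h} in
theorem isSemiinvariant_flowFactor {W : MvPolynomial (Fin n) ℂ} (hh : 0 < h)
    (hW : IsWeightedHomogeneous w W h) (t : ℝ) :
    IsSemiinvariant W (flowFactor w h t) (Complex.exp (2 * Real.pi * Complex.I * t)) := by
  have hh' : (h : ℂ) ≠ 0 := by exact_mod_cast hh.ne'
  have factor_eq : flowFactor w h t =
      fun i => Complex.exp (2 * Real.pi * Complex.I * t / h) ^ w i := by
    ext i
    rw [flowFactor, thetaJ, ← Complex.exp_nat_mul]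
    push_cast
    ring_nf
  have multiplier_eq : Complex.exp (2 * Real.pi * Complex.I * t) =
      Complex.exp (2 * Real.pi * Complex.I * t / h) ^ h := by
    rw [← Complex.exp_nat_mul, mul_div_cancel₀ _ hh']
  rw [factor_eq, multiplier_eq]
  exact isSemiinvariant_pow hW _

end Flow

section Twist

variable {n : ℕ} {W : MvPolynomial (Fin n) ℂ} {w : Fin n → ℕ} {h : ℕ} {g : Fin n → ℂˣ} {l : ℝ}

/-- The eigenvalues of the diagonal map `g ∘ R_l`, whose fixed points are the starting points of the
`g`-twisted orbits of period `l`. -/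
def twist (w : Fin n → ℕ) (h : ℕ) (g : Fin n → ℂˣ) (l : ℝ) : Fin n → ℂ :=
  fun i => (g i : ℂ) * flowFactor w h l i

theorem act_reebFlow (x : Fin n → ℂ) : act g (reebFlow w h l x) = twist w h g l * x :=
  funext fun _ => (mul_assoc _ _ _).symm

theorem mem_fixedLocus_iff {p : Fin n → ℂ} : p ∈ fixedLocus w h g l ↔ twist w h g l * p = p := by
  rw [← act_reebFlow]
  rfl

theorem norm_twist (hg : ∀ i, ‖(g i : ℂ)‖ = 1) (i : Fin n) : ‖twist w h g l i‖ = 1 := by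
  rw [twist, norm_mul, hg, norm_flowFactor, one_mul]

theorem isSemiinvariant_twist (hh : 0 < h) (hW : IsWeightedHomogeneous w W h)
    (hg : g ∈ symmetryGroup W) (l : ℝ) :
    IsSemiinvariant W (twist w h g l) (Complex.exp (2 * Real.pi * Complex.I * l)) := by
  intro x
  rw [← isSemiinvariant_flowFactor hh hW l x, ← hg (flowFactor w h l * x)]
  exact congrArg (fun y => eval y W) (mul_assoc _ _ x)

theorem twist_eq_of_notMem_indexSet (hh : 0 < h) (hW : IsWeightedHomogeneous w W h)
    (hg : g ∈ symmetryGroup W) {i : Fin n} (hi : i ∉ indexSet W w h g l) :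
    twist w h g l i = Complex.exp (2 * Real.pi * Complex.I * l) := by
  simp only [indexSet, Finset.mem_filter, Finset.mem_univ, true_and, not_forall] at hi
  obtain ⟨x, hx, hi⟩ := hi
  have h_partial := (isSemiinvariant_twist hh hW hg l).partialAt_mul i x
  rw [mem_fixedLocus_iff.mp hx, mul_comm] at h_partial
  exact mul_right_cancel₀ hi h_partial

theorem exp_theta {i : Fin n} (hg : ‖(g i : ℂ)‖ = 1) :
    Complex.exp (2 * Real.pi * Complex.I * theta g i) = g i := by
  have hpi : (Real.pi : ℂ) ≠ 0 := by exact_mod_cast Real.pi_ne_zero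
  have exp_arg : Complex.exp ((g i : ℂ).arg * Complex.I) = g i := by
    simpa [hg] using Complex.norm_mul_exp_arg_mul_I (g i : ℂ)
  rw [← exp_arg, Complex.exp_eq_exp_iff_exists_int]
  refine ⟨-⌊(g i : ℂ).arg / (2 * Real.pi)⌋, ?_⟩
  rw [theta, Int.fract]
  push_cast
  field_simp
  ring

theorem defect_twist {i : Fin n} (hg : ‖(g i : ℂ)‖ = 1) :
    defect (twist w h g l i) =
      Q (l * thetaJ w h i + theta g i) - 2 * (l * thetaJ w h i + theta g i) := by
  rw [← defect_exp_two_pi_mul, twist, ← exp_theta hg, flowFactor, ← Complex.exp_add]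
  congr 2
  push_cast
  ring

theorem sum_defect_twist (hh : 0 < h) (hW : IsWeightedHomogeneous w W h)
    (hg : g ∈ symmetryGroup W) (hg_norm : ∀ i, ‖(g i : ℂ)‖ = 1) :
    ∑ i, defect (twist w h g l i) =
      ∑ i ∈ indexSet W w h g l,
          (Q (l * thetaJ w h i + theta g i) - 2 * (l * thetaJ w h i + theta g i)) +
        ((indexSet W w h g l)ᶜ.card : ℝ) * (Q l - 2 * l) := by
  rw [← Finset.sum_add_sum_compl (indexSet W w h g l), ← nsmul_eq_mul, ← Finset.sum_const]
  congr 1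
  · exact Finset.sum_congr rfl fun i _ => defect_twist (hg_norm i)
  · refine Finset.sum_congr rfl fun i hi => ?_
    rw [twist_eq_of_notMem_indexSet hh hW hg (Finset.mem_compl.mp hi), defect_exp_two_pi_mul]

end Twist

theorem ne_zero_of_mem_link {n : ℕ} {W : MvPolynomial (Fin n) ℂ} {δ : ℝ} (hδ : 0 < δ)
    {p : Fin n → ℂ} (hp : p ∈ link W δ) : p ≠ 0 := by
  rintro rfl
  have radius_sq_eq : 0 = δ ^ 2 := by simpa using hp.2
  exact (pow_pos hδ 2).ne radius_sq_eq

/-! ### Unitary bases of the tangent spaces -/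

section Hermitian

variable {n : ℕ} (w : Fin n → ℕ)

/-- The linear map `v ↦ (vₖ / √(π wₖ))ₖ`, which carries the Hermitian form `herm w` to the standard
inner product of `ℂⁿ`. -/
def unweight : (Fin n → ℂ) →ₗ[ℂ] EuclideanSpace ℂ (Fin n) where
  toFun v := WithLp.toLp 2 fun k => v k / (√(Real.pi * w k) : ℝ)
  map_add' u v := by
    ext k
    exact add_div _ _ _
  map_smul' c v := by
    ext k
    exact mul_div_assoc _ _ _

theorem herm_eq_inner (u v : Fin n → ℂ) : herm w u v = inner ℂ (unweight w u) (unweight w v) := by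
  rw [herm, PiLp.inner_apply]
  refine Finset.sum_congr rfl fun k _ => ?_
  have sqrt_mul_self : ((√(Real.pi * w k) : ℝ) : ℂ) * (√(Real.pi * w k) : ℝ) = Real.pi * w k := by
    rw [← Complex.ofReal_mul, Real.mul_self_sqrt (by positivity)]
    push_cast
    rfl
  rw [RCLike.inner_apply, ← sqrt_mul_self]
  simp only [unweight, LinearMap.coe_mk, AddHom.coe_mk, map_div₀, Complex.conj_ofReal]
  rw [div_mul_div_comm, mul_comm (v k)]

theorem herm_smul_left (c : ℂ) (u v : Fin n → ℂ) :
    herm w (c • u) v = (starRingEnd ℂ) c * herm w u v := by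
  simp only [herm_eq_inner, map_smul, inner_smul_left]

theorem herm_smul_right (c : ℂ) (u v : Fin n → ℂ) : herm w u (c • v) = c * herm w u v := by
  simp only [herm_eq_inner, map_smul, inner_smul_right]

theorem herm_sum_right {ι : Type*} (s : Finset ι) (u : Fin n → ℂ) (v : ι → Fin n → ℂ) :
    herm w u (∑ i ∈ s, v i) = ∑ i ∈ s, herm w u (v i) := by
  simp only [herm_eq_inner, map_sum, inner_sum]

theorem conj_herm (u v : Fin n → ℂ) : (starRingEnd ℂ) (herm w u v) = herm w v u := by
  simp only [herm_eq_inner, inner_conj_symm]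

theorem herm_mul {T : Fin n → ℂ} (hT : ∀ i, ‖T i‖ = 1) (u v : Fin n → ℂ) :
    herm w (T * u) (T * v) = herm w u v := by
  refine Finset.sum_congr rfl fun k _ => ?_
  have conj_mul_self : (starRingEnd ℂ) (T k) * T k = 1 := by
    rw [Complex.conj_mul', hT, Complex.ofReal_one, one_pow]
  rw [Pi.mul_apply, Pi.mul_apply, map_mul, mul_mul_mul_comm, conj_mul_self, one_mul]

end Hermitian

theorem mem_tangentSpace {n : ℕ} {W : MvPolynomial (Fin n) ℂ} {x v : Fin n → ℂ} :
    v ∈ tangentSpace W x ↔ ∑ i, partialAt W i x * v i = 0 := by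
  simp [tangentSpace]

theorem IsSemiinvariant.mul_mem_tangentSpace {n : ℕ} {W : MvPolynomial (Fin n) ℂ}
    {T x v : Fin n → ℂ} {κ : ℂ} (hT : IsSemiinvariant W T κ) (hv : v ∈ tangentSpace W x) :
    T * v ∈ tangentSpace W (T * x) := by
  rw [mem_tangentSpace] at hv ⊢
  rw [hT.sum_partialAt_mul, hv, mul_zero]

section UnitaryBasis

variable {m : ℕ} {W : MvPolynomial (Fin (m + 1)) ℂ} {w : Fin (m + 1) → ℕ}
  {x : Fin (m + 1) → ℂ} {u v : Fin m → Fin (m + 1) → ℂ}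

theorem finrank_tangentSpace (hx : ∃ i, partialAt W i x ≠ 0) :
    Module.finrank ℂ (tangentSpace W x) = m := by
  obtain ⟨i, hi⟩ := hx
  have differential_ne_zero :
      ∑ i, partialAt W i x • (LinearMap.proj i : (Fin (m + 1) → ℂ) →ₗ[ℂ] ℂ) ≠ 0 := fun h =>
    hi (by simpa [Pi.single_apply] using LinearMap.congr_fun h (Pi.single i 1))
  have := Module.Dual.finrank_ker_add_one_of_ne_zero differential_ne_zero
  rw [Module.finrank_fin_fun] at this
  exact Nat.add_right_cancel this

/-- `v` is a unitary basis of `ker dW_x` for the Hermitian form `herm w`; a frame is a path of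
such bases. -/
structure IsUnitaryBasis (W : MvPolynomial (Fin (m + 1)) ℂ) (w : Fin (m + 1) → ℕ)
    (x : Fin (m + 1) → ℂ) (v : Fin m → Fin (m + 1) → ℂ) : Prop where
  tangent : ∀ j, v j ∈ tangentSpace W x
  unitary : ∀ i j, herm w (v i) (v j) = if i = j then 1 else 0

theorem exists_isUnitaryBasis (hw : ∀ i, 0 < w i) (hx : ∃ i, partialAt W i x ≠ 0) :
    ∃ v, IsUnitaryBasis W w x v := by
  set s : Fin (m + 1) → ℝ := fun k => √(Real.pi * w k)
  have s_ne_zero (k : Fin (m + 1)) : (s k : ℂ) ≠ 0 := by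
    have := hw k
    exact_mod_cast (show 0 < s k by positivity).ne'
  set ν : EuclideanSpace ℂ (Fin (m + 1)) :=
    WithLp.toLp 2 fun k => (starRingEnd ℂ) (partialAt W k x * s k)
  have ν_ne_zero : ν ≠ 0 := by
    obtain ⟨i, hi⟩ := hx
    exact fun h => mul_ne_zero hi (s_ne_zero i)
      ((map_eq_zero _).mp (congrArg (fun y : EuclideanSpace ℂ (Fin (m + 1)) => y i) h))
  have : Fact (Module.finrank ℂ (EuclideanSpace ℂ (Fin (m + 1))) = m + 1) := ⟨by simp⟩
  let e := OrthonormalBasis.fromOrthogonalSpanSingleton (𝕜 := ℂ) m ν_ne_zero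
  have unweight_eq (j : Fin m) : unweight w (fun k => s k * (e j).1 k) = (e j).1 := by
    ext k
    exact mul_div_cancel_left₀ _ (s_ne_zero k)
  refine ⟨fun j k => s k * (e j).1 k, fun j => ?_, fun i j => ?_⟩
  · have inner_eq_zero : inner ℂ ν (e j).1 = 0 :=
      Submodule.mem_orthogonal_singleton_iff_inner_right.mp (e j).2
    rw [mem_tangentSpace, ← inner_eq_zero, PiLp.inner_apply]
    refine Finset.sum_congr rfl fun k _ => ?_
    rw [RCLike.inner_apply, Complex.conj_conj]
    ring
  · rw [herm_eq_inner, unweight_eq, unweight_eq, ← Submodule.coe_inner]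
    exact orthonormal_iff_ite.mp e.orthonormal i j

/-- The matrix `⟨vᵢ, uⱼ⟩` of the coordinates of the vectors `uⱼ` in a unitary basis `v`. -/
def coordMatrix (w : Fin (m + 1) → ℕ) (v u : Fin m → Fin (m + 1) → ℂ) :
    Matrix (Fin m) (Fin m) ℂ :=
  Matrix.of fun i j => herm w (v i) (u j)

namespace IsUnitaryBasis

theorem mul {T : Fin (m + 1) → ℂ} {κ : ℂ} (hv : IsUnitaryBasis W w x v)
    (hT : IsSemiinvariant W T κ) (hT_norm : ∀ i, ‖T i‖ = 1) :
    IsUnitaryBasis W w (T * x) fun j => T * v j where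
  tangent j := hT.mul_mem_tangentSpace (hv.tangent j)
  unitary i j := by rw [herm_mul w hT_norm, hv.unitary]

theorem smul {c : Fin m → ℂ} (hv : IsUnitaryBasis W w x v) (hc : ∀ j, ‖c j‖ = 1) :
    IsUnitaryBasis W w x fun j => c j • v j where
  tangent j := Submodule.smul_mem _ _ (hv.tangent j)
  unitary i j := by
    rw [herm_smul_left, herm_smul_right, hv.unitary]
    split_ifs with hij
    · rw [hij, mul_one, Complex.conj_mul', hc, Complex.ofReal_one, one_pow]
    · rw [mul_zero, mul_zero]

theorem orthonormal_unweight (hv : IsUnitaryBasis W w x v) :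
    Orthonormal ℂ fun j => unweight w (v j) :=
  orthonormal_iff_ite.mpr fun i j => by rw [← herm_eq_inner, hv.unitary]

theorem linearIndependent (hv : IsUnitaryBasis W w x v) : LinearIndependent ℂ v :=
  hv.orthonormal_unweight.linearIndependent.of_comp _

theorem span_eq (hv : IsUnitaryBasis W w x v) (hx : ∃ i, partialAt W i x ≠ 0) :
    Submodule.span ℂ (Set.range v) = tangentSpace W x :=
  Submodule.eq_of_le_of_finrank_eq
    (Submodule.span_le.mpr (Set.range_subset_iff.mpr hv.tangent))
    (by rw [finrank_span_eq_card hv.linearIndependent, finrank_tangentSpace hx, Fintype.card_fin])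

theorem sum_herm_smul (hv : IsUnitaryBasis W w x v) (hx : ∃ i, partialAt W i x ≠ 0)
    {y : Fin (m + 1) → ℂ} (hy : y ∈ tangentSpace W x) : ∑ i, herm w (v i) y • v i = y := by
  rw [← hv.span_eq hx, Submodule.mem_span_range_iff_exists_fun] at hy
  obtain ⟨c, rfl⟩ := hy
  refine Finset.sum_congr rfl fun i _ => ?_
  simp [herm_sum_right, herm_smul_right, hv.unitary]

theorem sum_coordMatrix_smul (hv : IsUnitaryBasis W w x v) (hx : ∃ i, partialAt W i x ≠ 0)
    (hu : ∀ j, u j ∈ tangentSpace W x) (j : Fin m) : ∑ i, coordMatrix w v u i j • v i = u j :=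
  hv.sum_herm_smul hx (hu j)

theorem coordMatrix_mem_unitaryGroup (hv : IsUnitaryBasis W w x v) (hu : IsUnitaryBasis W w x u)
    (hx : ∃ i, partialAt W i x ≠ 0) : coordMatrix w v u ∈ Matrix.unitaryGroup (Fin m) ℂ := by
  rw [Matrix.mem_unitaryGroup_iff']
  ext j k
  have h := hu.unitary j k
  rw [← hv.sum_coordMatrix_smul hx hu.tangent k, herm_sum_right] at h
  rw [Matrix.one_apply, ← h, Matrix.mul_apply]
  refine Finset.sum_congr rfl fun i _ => ?_
  rw [herm_smul_right, mul_comm]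
  exact congrArg (_ * ·) (conj_herm w (v i) (u j))

end IsUnitaryBasis

end UnitaryBasis

/-! ### The residue form and the spectrum of a diagonal map -/

section Border

variable {R : Type*} [CommRing R] {m : ℕ}

/-- The block diagonal matrix with blocks `κ` and `A`: the matrix of a linear map of `ℂᵐ⁺¹` in a
basis that consists of a normal vector and a basis of the tangent space. -/
def border (κ : R) (A : Matrix (Fin m) (Fin m) R) : Matrix (Fin (m + 1)) (Fin (m + 1)) R :=
  Matrix.of (Fin.cons (Fin.cons κ 0) fun i => Fin.cons 0 (A i))

theorem border_mul_cons (κ : R) (A : Matrix (Fin m) (Fin m) R) {n : Type*} (ν : n → R)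
    (v : Fin m → n → R) :
    border κ A * Matrix.of (Fin.cons ν v) =
      Matrix.of (Fin.cons (κ • ν) fun j => ∑ i, A j i • v i) := by
  ext i k
  rw [Matrix.mul_apply, Fin.sum_univ_succ]
  cases i using Fin.cases <;> simp [border]

theorem det_border (κ : R) (A : Matrix (Fin m) (Fin m) R) : (border κ A).det = κ * A.det := by
  have minor_eq : (border κ A).submatrix Fin.succ (Fin.succAbove 0) = A := by
    ext i j
    simp [border]
  rw [Matrix.det_succ_row_zero, Fin.sum_univ_succ, minor_eq]
  simp [border]

theorem charpoly_border (κ : R) (A : Matrix (Fin m) (Fin m) R) :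
    (border κ A).charpoly = (Polynomial.X - Polynomial.C κ) * A.charpoly := by
  have charmatrix_eq :
      (border κ A).charmatrix = border (Polynomial.X - Polynomial.C κ) A.charmatrix := by
    ext i j : 2
    cases i using Fin.cases <;> cases j using Fin.cases <;>
      simp [border, Matrix.charmatrix_apply, Matrix.diagonal_apply, Fin.succ_ne_zero,
        (Fin.succ_ne_zero _).symm]
  rw [Matrix.charpoly, charmatrix_eq, det_border, ← Matrix.charpoly]

end Border

section ResidueForm

variable {m : ℕ} {W : MvPolynomial (Fin (m + 1)) ℂ} {w : Fin (m + 1) → ℕ}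
  {x T : Fin (m + 1) → ℂ} {κ : ℂ} {u v : Fin m → Fin (m + 1) → ℂ}

open scoped ComplexOrder in
theorem gradient_sq_ne_zero (hx : ∃ i, partialAt W i x ≠ 0) :
    ∑ i, partialAt W i x * (starRingEnd ℂ) (partialAt W i x) ≠ 0 := by
  obtain ⟨i, hi⟩ := hx
  exact fun h => hi (congrFun (dotProduct_self_star_eq_zero (v := fun i => partialAt W i x).mp h) i)

/-- The matrix whose rows are the conjugate gradient, which is a normal vector of the tangent space,
and the vectors `vⱼ`.  Its determinant is the numerator of the residue form. -/
def frameMatrix (W : MvPolynomial (Fin (m + 1)) ℂ) (x : Fin (m + 1) → ℂ)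
    (v : Fin m → Fin (m + 1) → ℂ) : Matrix (Fin (m + 1)) (Fin (m + 1)) ℂ :=
  Matrix.of (Fin.cons (fun i => (starRingEnd ℂ) (partialAt W i x)) v)

theorem residueForm_eq_div : residueForm W x v =
    (frameMatrix W x v).det / ∑ i, partialAt W i x * (starRingEnd ℂ) (partialAt W i x) :=
  rfl

theorem IsSemiinvariant.mul_residueForm_mul (hT : IsSemiinvariant W T κ) (hκ : κ ≠ 0)
    (hx : ∃ i, partialAt W i x ≠ 0) (hv : ∀ j, v j ∈ tangentSpace W x) :
    κ * residueForm W (T * x) (fun j => T * v j) = (∏ i, T i) * residueForm W x v := by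
  set ν : Fin (m + 1) → ℂ := fun i => (starRingEnd ℂ) (partialAt W i x)
  have rows_mul : Matrix.of (Fin.cons (T * ν) fun j => T * v j) =
      Matrix.of (Fin.cons ν v) * Matrix.diagonal T := by
    ext i k
    rw [Matrix.mul_diagonal]
    cases i using Fin.cases <;> exact mul_comm _ _
  have at_image := mul_residueForm W (T * x) (T * ν) (fun j => T * v j)
    (hT.exists_partialAt_ne_zero hκ hx) fun j =>
      mem_tangentSpace.mp (hT.mul_mem_tangentSpace (hv j))
  rw [hT.sum_partialAt_mul, rows_mul, Matrix.det_mul, Matrix.det_diagonal,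
    ← mul_residueForm W x ν v hx fun j => mem_tangentSpace.mp (hv j)] at at_image
  refine mul_left_cancel₀ (gradient_sq_ne_zero hx) ?_
  linear_combination at_image

namespace IsUnitaryBasis

theorem det_frameMatrix_ne_zero (hv : IsUnitaryBasis W w x v) (hx : ∃ i, partialAt W i x ≠ 0) :
    (frameMatrix W x v).det ≠ 0 := by
  have linearIndependent_rows : LinearIndependent ℂ (frameMatrix W x v).row := by
    refine hv.linearIndependent.finCons fun h => ?_
    rw [hv.span_eq hx, mem_tangentSpace] at h
    exact gradient_sq_ne_zero hx h
  exact ((Matrix.isUnit_iff_isUnit_det _).mp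
    (Matrix.linearIndependent_rows_iff_isUnit.mp linearIndependent_rows)).ne_zero

theorem residueForm_ne_zero (hv : IsUnitaryBasis W w x v) (hx : ∃ i, partialAt W i x ≠ 0) :
    residueForm W x v ≠ 0 :=
  div_ne_zero (hv.det_frameMatrix_ne_zero hx) (gradient_sq_ne_zero hx)

theorem residueForm_eq_det_mul (hv : IsUnitaryBasis W w x v) (hx : ∃ i, partialAt W i x ≠ 0)
    (hu : ∀ j, u j ∈ tangentSpace W x) :
    residueForm W x u = (coordMatrix w v u).det * residueForm W x v := by
  have frameMatrix_eq :
      frameMatrix W x u = border 1 (coordMatrix w v u).transpose * frameMatrix W x v := by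
    rw [frameMatrix, frameMatrix, border_mul_cons, one_smul]
    exact congrArg _ (congrArg _ (funext fun j => (hv.sum_coordMatrix_smul hx hu j).symm))
  rw [residueForm_eq_div, residueForm_eq_div, frameMatrix_eq, Matrix.det_mul, det_border, one_mul,
    Matrix.det_transpose, mul_div_assoc]

/-- The conjugate gradient is an eigenvector for the eigenvalue `κ` of a diagonal map that fixes
`x`, since `Tᵢ = κ` wherever `∂ᵢW(x) ≠ 0`. -/
theorem charpoly_diagonal (hv : IsUnitaryBasis W w x v) (hx : ∃ i, partialAt W i x ≠ 0)
    (hT : IsSemiinvariant W T κ) (hTx : T * x = x) :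
    (Matrix.diagonal T).charpoly =
      (Polynomial.X - Polynomial.C κ) * (coordMatrix w v fun j => T * v j).charpoly := by
  set A := coordMatrix w v fun j => T * v j
  set P := frameMatrix W x v with hP
  have isUnit_det : IsUnit P.det := (hv.det_frameMatrix_ne_zero hx).isUnit
  have normal_eq :
      (fun i => (starRingEnd ℂ) (partialAt W i x) * T i) =
        κ • fun i => (starRingEnd ℂ) (partialAt W i x) := by
    ext i
    have h := hT.partialAt_mul i x
    rw [hTx, mul_comm] at h
    rcases eq_or_ne (partialAt W i x) 0 with h_zero | h_ne
    · simp [h_zero]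
    · rw [Pi.smul_apply, smul_eq_mul, mul_comm, mul_right_cancel₀ h_ne h]
  have tangent (j : Fin m) : T * v j ∈ tangentSpace W x := by
    simpa only [hTx] using hT.mul_mem_tangentSpace (hv.tangent j)
  have intertwines : P * Matrix.diagonal T = border κ A.transpose * P := by
    rw [hP, frameMatrix, border_mul_cons, ← normal_eq]
    ext i k
    rw [Matrix.mul_diagonal]
    cases i using Fin.cases with
    | zero => rfl
    | succ j => exact (mul_comm _ _).trans (congrFun (hv.sum_coordMatrix_smul hx tangent j) k).symm
  have conjugate : Matrix.diagonal T = P⁻¹ * (border κ A.transpose * P) := by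
    rw [← intertwines, ← mul_assoc, Matrix.nonsing_inv_mul _ isUnit_det, one_mul]
  rw [conjugate, Matrix.charpoly_mul_comm, mul_assoc, Matrix.mul_nonsing_inv _ isUnit_det, mul_one,
    charpoly_border, Matrix.charpoly_transpose]

end IsUnitaryBasis

end ResidueForm

section Spectrum

variable {m : ℕ} {W : MvPolynomial (Fin (m + 1)) ℂ} {w : Fin (m + 1) → ℕ}
  {x T : Fin (m + 1) → ℂ} {κ : ℂ} {v : Fin m → Fin (m + 1) → ℂ}

theorem IsUnitaryBasis.sum_eq_add_spectralSum (hv : IsUnitaryBasis W w x v)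
    (hx : ∃ i, partialAt W i x ≠ 0) (hT : IsSemiinvariant W T κ) (hTx : T * x = x) (r : ℂ → ℝ) :
    ∑ i, r (T i) =
      r κ + spectralSum r (Matrix.toEuclideanCLM (𝕜 := ℂ) (coordMatrix w v fun j => T * v j)) := by
  rw [← spectralSum_toEuclideanCLM_diagonal, spectralSum_toEuclideanCLM,
    spectralSum_toEuclideanCLM, hv.charpoly_diagonal hx hT hTx,
    Polynomial.roots_mul (mul_ne_zero (Polynomial.X_sub_C_ne_zero _)
      (Matrix.charpoly_monic _).ne_zero),
    Polynomial.roots_X_sub_C, Multiset.map_add, Multiset.sum_add, Multiset.map_singleton,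
    Multiset.sum_singleton]

end Spectrum

/-! ### The index of the linearized flow in a unitary frame -/

theorem eq_exp_of_polar {z c c' : ℂ} {s φ φ' : ℝ} (hz : ‖z‖ = 1) (hc' : c' ≠ 0)
    (hφ : c = ‖c‖ * Complex.exp (2 * Real.pi * Complex.I * φ))
    (hφ' : c' = ‖c'‖ * Complex.exp (2 * Real.pi * Complex.I * φ'))
    (h : Complex.exp (2 * Real.pi * Complex.I * s) * c = z * c') :
    z = Complex.exp (2 * Real.pi * Complex.I * ((s + φ - φ' : ℝ) : ℂ)) := by
  have norm_eq : ‖c‖ = ‖c'‖ := by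
    simpa only [norm_mul, norm_exp_two_pi_mul, hz, one_mul] using congrArg norm h
  have exp_add_eq : Complex.exp (2 * Real.pi * Complex.I * ((s + φ - φ' : ℝ) : ℂ)) *
      Complex.exp (2 * Real.pi * Complex.I * φ') =
      Complex.exp (2 * Real.pi * Complex.I * s) * Complex.exp (2 * Real.pi * Complex.I * φ) := by
    rw [← Complex.exp_add, ← Complex.exp_add]
    congr 1
    push_cast
    ring
  refine mul_right_cancel₀ hc' ?_
  rw [← h, hφ, hφ', norm_eq]
  linear_combination -(‖c'‖ : ℂ) * exp_add_eq

section UnitaryFrame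

variable {m : ℕ} {W : MvPolynomial (Fin (m + 1)) ℂ} {w : Fin (m + 1) → ℕ} {h : ℕ}
  {g : Fin (m + 1) → ℂˣ} {l : ℝ} {p : Fin (m + 1) → ℂ} {F : ℝ → Fin m → Fin (m + 1) → ℂ}

theorem residueForm_reebFlow (hh : 0 < h) (hW : IsWeightedHomogeneous w W h)
    (hp : ∃ i, partialAt W i p ≠ 0) {v : Fin m → Fin (m + 1) → ℂ}
    (hv : ∀ j, v j ∈ tangentSpace W p) (t : ℝ) :
    residueForm W (reebFlow w h t p) (fun j => reebFlow w h t (v j)) =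
      Complex.exp (2 * Real.pi * Complex.I * ((t * (∑ i, thetaJ w h i - 1) : ℝ) : ℂ)) *
        residueForm W p v := by
  have semiinvariance := (isSemiinvariant_flowFactor hh hW t).mul_residueForm_mul
    (Complex.exp_ne_zero _) hp hv
  rw [prod_flowFactor] at semiinvariance
  refine mul_left_cancel₀ (Complex.exp_ne_zero (2 * Real.pi * Complex.I * t))
    (semiinvariance.trans ?_)
  rw [← mul_assoc, ← Complex.exp_add]
  congr 2
  push_cast
  ring

theorem exists_partialAt_reebFlow_ne_zero (hh : 0 < h) (hW : IsWeightedHomogeneous w W h)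
    (hp : ∃ i, partialAt W i p ≠ 0) (t : ℝ) : ∃ i, partialAt W i (reebFlow w h t p) ≠ 0 :=
  (isSemiinvariant_flowFactor hh hW t).exists_partialAt_ne_zero (Complex.exp_ne_zero _) hp

theorem IsUnitaryBasis.reebFlow {v : Fin m → Fin (m + 1) → ℂ} (hv : IsUnitaryBasis W w p v)
    (hh : 0 < h) (hW : IsWeightedHomogeneous w W h) (t : ℝ) :
    IsUnitaryBasis W w (reebFlow w h t p) fun j => reebFlow w h t (v j) :=
  hv.mul (isSemiinvariant_flowFactor hh hW t) (norm_flowFactor w h t)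

/-- The unitary matrix of the linearized Reeb flow in the frame `F`. -/
def flowMatrix (w : Fin (m + 1) → ℕ) (h : ℕ) (F : ℝ → Fin m → Fin (m + 1) → ℂ) (t : ℝ) :
    Matrix (Fin m) (Fin m) ℂ :=
  coordMatrix w (F t) fun j => reebFlow w h t (F 0 j)

theorem linearizedFlow_eq : linearizedFlow w h F =
    fun t => (Matrix.toEuclideanCLM (𝕜 := ℂ) (flowMatrix w h F t)).restrictScalars ℝ :=
  rfl

namespace IsUnitaryFrame

theorem isUnitaryBasis (hF : IsUnitaryFrame W w h g l p F) {t : ℝ} (ht : t ∈ Set.Icc 0 l) :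
    IsUnitaryBasis W w (reebFlow w h t p) (F t) :=
  ⟨hF.tangent t ht, hF.unitary t ht⟩

theorem isUnitaryBasis_zero (hF : IsUnitaryFrame W w h g l p F) (hl : 0 ≤ l) :
    IsUnitaryBasis W w p (F 0) := by
  simpa only [reebFlow_zero] using hF.isUnitaryBasis (Set.left_mem_Icc.mpr hl)

theorem flowMatrix_zero (hF : IsUnitaryFrame W w h g l p F) (hl : 0 ≤ l) :
    flowMatrix w h F 0 = 1 := by
  ext i j
  rw [flowMatrix, coordMatrix, Matrix.of_apply, reebFlow_zero,
    (hF.isUnitaryBasis_zero hl).unitary, Matrix.one_apply]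

theorem flowMatrix_end (hF : IsUnitaryFrame W w h g l p F) (hg : ∀ i, ‖(g i : ℂ)‖ = 1) :
    flowMatrix w h F l = coordMatrix w (F 0) fun j => twist w h g l * F 0 j := by
  ext i j
  calc herm w (F l i) (reebFlow w h l (F 0 j))
      = herm w (act g (F l i)) (act g (reebFlow w h l (F 0 j))) := (herm_mul w hg _ _).symm
    _ = herm w (F 0 i) (twist w h g l * F 0 j) := by rw [hF.equivariant, act_reebFlow]

theorem flowMatrix_mem_unitaryGroup (hF : IsUnitaryFrame W w h g l p F) (hh : 0 < h)
    (hW : IsWeightedHomogeneous w W h) (hp : ∃ i, partialAt W i p ≠ 0) {t : ℝ}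
    (ht : t ∈ Set.Icc 0 l) : flowMatrix w h F t ∈ Matrix.unitaryGroup (Fin m) ℂ :=
  (hF.isUnitaryBasis ht).coordMatrix_mem_unitaryGroup
    ((hF.isUnitaryBasis_zero (ht.1.trans ht.2)).reebFlow hh hW t)
    (exists_partialAt_reebFlow_ne_zero hh hW hp t)

theorem residueForm_eq (hF : IsUnitaryFrame W w h g l p F) (hh : 0 < h)
    (hW : IsWeightedHomogeneous w W h) (hp : ∃ i, partialAt W i p ≠ 0) {t : ℝ}
    (ht : t ∈ Set.Icc 0 l) :
    Complex.exp (2 * Real.pi * Complex.I * ((t * (∑ i, thetaJ w h i - 1) : ℝ) : ℂ)) *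
        residueForm W p (F 0) =
      (flowMatrix w h F t).det * residueForm W (reebFlow w h t p) (F t) := by
  have basis_zero := hF.isUnitaryBasis_zero (ht.1.trans ht.2)
  rw [← residueForm_reebFlow hh hW hp basis_zero.tangent]
  exact (hF.isUnitaryBasis ht).residueForm_eq_det_mul
    (exists_partialAt_reebFlow_ne_zero hh hW hp t) (basis_zero.reebFlow hh hW t).tangent

theorem index_add_rotation (hF : IsUnitaryFrame W w h g l p F) (hh : 0 < h)
    (hW : IsWeightedHomogeneous w W h) (hg : g ∈ symmetryGroup W)
    (hg_norm : ∀ i, ‖(g i : ℂ)‖ = 1) (hl : 0 < l) (hp : ∃ i, partialAt W i p ≠ 0)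
    (hfix : p ∈ fixedLocus w h g l) (hreg : IsRegularPath (linearizedFlow w h F) 0 l) {ρ : ℝ}
    (hρ : IsRotationNumber (fun t => residueForm W (reebFlow w h t p) (F t)) 0 l ρ) :
    index (linearizedFlow w h F) 0 l + 2 * ρ =
      ∑ i, defect (twist w h g l i) - (Q l - 2 * l) + 2 * (l * (∑ i, thetaJ w h i - 1)) := by
  obtain ⟨φ, hφ, polar, rfl⟩ := hρ
  have zero_mem : (0 : ℝ) ∈ Set.Icc 0 l := Set.left_mem_Icc.mpr hl.le
  set U := fun t => Matrix.toEuclideanCLM (𝕜 := ℂ) (flowMatrix w h F t) with hU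
  have mem_unitary (t : ℝ) (ht : t ∈ Set.Icc 0 l) : 
      U t ∈ _root_.unitary (EuclideanSpace ℂ (Fin m) →L[ℂ] EuclideanSpace ℂ (Fin m)) :=
    Unitary.map_mem (Matrix.toEuclideanCLM (𝕜 := ℂ) (n := Fin m))
      (hF.flowMatrix_mem_unitaryGroup hh hW hp ht)
  have det_eq (t : ℝ) (ht : t ∈ Set.Icc 0 l) : (U t).det = Complex.exp
      (2 * Real.pi * Complex.I * ((t * (∑ i, thetaJ w h i - 1) + φ 0 - φ t : ℝ) : ℂ)) := by
    have norm_det : ‖(flowMatrix w h F t).det‖ = 1 := CStarRing.norm_of_mem_unitary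
      (Matrix.det_of_mem_unitary (hF.flowMatrix_mem_unitaryGroup hh hW hp ht))
    have polar_zero := (polar 0 zero_mem).2
    simp only [reebFlow_zero] at polar_zero
    rw [hU, det_toEuclideanCLM]
    exact eq_exp_of_polar norm_det (polar t ht).1 polar_zero (polar t ht).2
      (hF.residueForm_eq hh hW hp ht)
  have spectralSum_zero : spectralSum defect (U 0) = 0 := by
    have U_zero : U 0 = Matrix.toEuclideanCLM (𝕜 := ℂ) (Matrix.diagonal fun _ => 1) := by
      rw [hU, Matrix.diagonal_one, ← hF.flowMatrix_zero hl.le]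
    rw [U_zero, spectralSum_toEuclideanCLM_diagonal]
    exact Finset.sum_eq_zero fun _ _ => defect_one
  have spectralSum_end := (hF.isUnitaryBasis_zero hl.le).sum_eq_add_spectralSum hp
    (isSemiinvariant_twist hh hW hg l) (mem_fixedLocus_iff.mp hfix) defect
  rw [← hF.flowMatrix_end hg_norm, defect_exp_two_pi_mul] at spectralSum_end
  rw [linearizedFlow_eq, index_eq_sub (A := U) hl mem_unitary hreg (by fun_prop) det_eq,
    spectralSum_zero, spectralSum_end]
  ring

end IsUnitaryFrame

end UnitaryFrame

/-! ### Existence of frames -/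

section RotatingFrame

variable {m : ℕ} {W : MvPolynomial (Fin (m + 1)) ℂ} {w : Fin (m + 1) → ℕ} {h : ℕ}
  {g : Fin (m + 1) → ℂˣ} {l : ℝ} {p x : Fin (m + 1) → ℂ} {T : Fin (m + 1) → ℂ} {κ : ℂ}
  {u v : Fin m → Fin (m + 1) → ℂ} {s : Fin m → ℝ}

namespace IsUnitaryBasis

theorem herm_sum_smul (hu : IsUnitaryBasis W w x u) (a b : EuclideanSpace ℂ (Fin m)) :
    herm w (∑ i, a i • u i) (∑ i, b i • u i) = inner ℂ a b := by
  simp only [herm_eq_inner, map_sum, map_smul]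
  rw [hu.orthonormal_unweight.inner_sum, PiLp.inner_apply]
  simp only [RCLike.inner_apply, mul_comm]

theorem mul_sum_smul (hu : IsUnitaryBasis W w x u) (hx : ∃ i, partialAt W i x ≠ 0)
    (hT : IsSemiinvariant W T κ) (hTx : T * x = x) (a : EuclideanSpace ℂ (Fin m)) :
    T * ∑ i, a i • u i = ∑ i, Matrix.toEuclideanCLM (𝕜 := ℂ)
      (coordMatrix w u fun j => T * u j) a i • u i := by
  have tangent (j : Fin m) : T * u j ∈ tangentSpace W x := by
    simpa only [hTx] using hT.mul_mem_tangentSpace (hu.tangent j)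
  calc T * ∑ j, a j • u j
      = ∑ j, a j • ∑ i, coordMatrix w u (fun j => T * u j) i j • u i := by
        simp only [Finset.mul_sum, mul_smul_comm, hu.sum_coordMatrix_smul hx tangent]
    _ = ∑ i, (∑ j, coordMatrix w u (fun j => T * u j) i j * a j) • u i := by
        simp only [Finset.smul_sum, Finset.sum_smul, smul_smul, mul_comm (a _)]
        exact Finset.sum_comm

theorem exists_eigenbasis (hu : IsUnitaryBasis W w x u) (hx : ∃ i, partialAt W i x ≠ 0)
    (hT : IsSemiinvariant W T κ) (hT_norm : ∀ i, ‖T i‖ = 1) (hTx : T * x = x) :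
    ∃ (v : Fin m → Fin (m + 1) → ℂ) (s : Fin m → ℝ), IsUnitaryBasis W w x v ∧ (∀ j, 0 < s j) ∧
      ∀ j, T * v j = Complex.exp (2 * Real.pi * Complex.I * s j) • v j := by
  have hTu : IsUnitaryBasis W w x fun j => T * u j := by
    simpa only [hTx] using hu.mul hT hT_norm
  obtain ⟨b, s, hs, hb⟩ := exists_eigenbasis_of_mem_unitary finrank_euclideanSpace_fin
    (Unitary.map_mem (Matrix.toEuclideanCLM (𝕜 := ℂ) (n := Fin m))
      (hu.coordMatrix_mem_unitaryGroup hTu hx))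
  refine ⟨fun j => ∑ i, b j i • u i, s, ⟨fun j => ?_, fun i j => ?_⟩, hs, fun j => ?_⟩
  · exact Submodule.sum_mem _ fun i _ => Submodule.smul_mem _ _ (hu.tangent i)
  · rw [hu.herm_sum_smul, orthonormal_iff_ite.mp b.orthonormal]
  · rw [hu.mul_sum_smul hx hT hTx, hb, Finset.smul_sum]
    simp only [PiLp.smul_apply, smul_assoc]

end IsUnitaryBasis

/-- The frame along a Reeb orbit obtained from a basis `v` at its starting point by the linearized
Reeb flow, each vector `vⱼ` being rotated back with the constant speed `sⱼ`.  If `vⱼ` is an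
eigenvector of `g R_l` for the eigenvalue `exp (2πi l sⱼ)`, the rotation makes it equivariant. -/
def rotatingFrame (w : Fin (m + 1) → ℕ) (h : ℕ) (s : Fin m → ℝ) (v : Fin m → Fin (m + 1) → ℂ)
    (t : ℝ) (j : Fin m) : Fin (m + 1) → ℂ :=
  Complex.exp (2 * Real.pi * Complex.I * ((t * -s j : ℝ) : ℂ)) • reebFlow w h t (v j)

theorem rotatingFrame_zero : rotatingFrame w h s v 0 = v := by
  ext j : 1
  simp [rotatingFrame, reebFlow_zero]

theorem contDiff_rotatingFrame : ContDiff ℝ 1 (rotatingFrame w h s v) :=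
  contDiff_pi.mpr fun _ => contDiff_pi.mpr fun _ =>
    (contDiff_exp_two_pi_mul _).mul ((contDiff_exp_two_pi_mul _).mul contDiff_const)

theorem act_rotatingFrame
    (hs : ∀ j, twist w h g l * v j =
      Complex.exp (2 * Real.pi * Complex.I * ((l * s j : ℝ) : ℂ)) • v j) (j : Fin m) :
    act g (rotatingFrame w h s v l j) = v j := by
  set c := Complex.exp (2 * Real.pi * Complex.I * ((l * -s j : ℝ) : ℂ)) with hc
  have act_smul : act g (c • reebFlow w h l (v j)) = c • act g (reebFlow w h l (v j)) :=
    funext fun i => mul_left_comm _ _ _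
  have cancel : c * Complex.exp (2 * Real.pi * Complex.I * ((l * s j : ℝ) : ℂ)) = 1 := by
    rw [hc, ← Complex.exp_add, ← Complex.exp_zero]
    congr 1
    push_cast
    ring
  rw [rotatingFrame, act_smul, act_reebFlow, hs, smul_smul, cancel, one_smul]

theorem IsUnitaryBasis.isUnitaryFrame_rotatingFrame (hv : IsUnitaryBasis W w p v) (hh : 0 < h)
    (hW : IsWeightedHomogeneous w W h)
    (hs : ∀ j, twist w h g l * v j =
      Complex.exp (2 * Real.pi * Complex.I * ((l * s j : ℝ) : ℂ)) • v j) :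
    IsUnitaryFrame W w h g l p (rotatingFrame w h s v) := by
  have basis (t : ℝ) : IsUnitaryBasis W w (LGOrbifold.reebFlow w h t p)
      (rotatingFrame w h s v t) :=
    (hv.reebFlow hh hW t).smul fun _ => norm_exp_two_pi_mul _
  exact ⟨contDiff_rotatingFrame.contDiffOn, fun t _ => (basis t).tangent,
    fun t _ => (basis t).unitary, fun j => by rw [rotatingFrame_zero, act_rotatingFrame hs]⟩

theorem IsUnitaryBasis.flowMatrix_rotatingFrame (hv : IsUnitaryBasis W w p v) (hh : 0 < h)
    (hW : IsWeightedHomogeneous w W h) (t : ℝ) :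
    flowMatrix w h (rotatingFrame w h s v) t = Matrix.diagonal fun j =>
      Complex.exp (2 * Real.pi * Complex.I * ((t * s j : ℝ) : ℂ)) := by
  ext i j
  rw [flowMatrix, rotatingFrame_zero, coordMatrix, Matrix.of_apply, rotatingFrame, herm_smul_left,
    (hv.reebFlow hh hW t).unitary, conj_exp_two_pi_mul, Matrix.diagonal_apply, mul_ite, mul_one,
    mul_zero, mul_neg, neg_neg]

theorem IsUnitaryFrame.isRotationNumber_rotatingFrame
    (hF : IsUnitaryFrame W w h g l p (rotatingFrame w h s v)) (hl : 0 ≤ l) (hh : 0 < h)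
    (hW : IsWeightedHomogeneous w W h) (hp : ∃ i, partialAt W i p ≠ 0) :
    IsRotationNumber (fun t => residueForm W (reebFlow w h t p) (rotatingFrame w h s v t)) 0 l
      (l * (∑ i, thetaJ w h i - 1 - ∑ j, s j)) := by
  have hv : IsUnitaryBasis W w p v := by
    simpa only [rotatingFrame_zero] using hF.isUnitaryBasis_zero hl
  suffices ∀ t ∈ Set.Icc 0 l, residueForm W (reebFlow w h t p) (rotatingFrame w h s v t) =
      Complex.exp (2 * Real.pi * Complex.I * ((t * (∑ i, thetaJ w h i - 1 - ∑ j, s j) : ℝ) : ℂ)) *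
        residueForm W p v by
    simpa only [sub_zero] using isRotationNumber_exp_mul (hv.residueForm_ne_zero hp) this
  intro t ht
  have residueForm_eq := hF.residueForm_eq hh hW hp ht
  rw [rotatingFrame_zero, hv.flowMatrix_rotatingFrame hh hW, Matrix.det_diagonal,
    ← Complex.exp_sum, ← Finset.mul_sum, ← Complex.ofReal_sum, ← Finset.mul_sum] at residueForm_eq
  refine mul_left_cancel₀ (Complex.exp_ne_zero _) (residueForm_eq.symm.trans ?_)
  rw [← mul_assoc, ← Complex.exp_add]
  congr 2
  push_cast
  ring

theorem exists_isUnitaryFrame (hw : ∀ i, 0 < w i) (hh : 0 < h)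
    (hW : IsWeightedHomogeneous w W h) (hg : g ∈ symmetryGroup W)
    (hg_norm : ∀ i, ‖(g i : ℂ)‖ = 1) (hl : 0 < l) (hp : ∃ i, partialAt W i p ≠ 0)
    (hfix : p ∈ fixedLocus w h g l) :
    ∃ (F : ℝ → Fin m → Fin (m + 1) → ℂ) (ρ : ℝ), IsUnitaryFrame W w h g l p F ∧
      IsRegularPath (linearizedFlow w h F) 0 l ∧
      IsRotationNumber (fun t => residueForm W (reebFlow w h t p) (F t)) 0 l ρ := by
  obtain ⟨u, hu⟩ := exists_isUnitaryBasis hw hp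
  obtain ⟨v, s, hv, hs, eigen⟩ := hu.exists_eigenbasis hp (isSemiinvariant_twist hh hW hg l)
    (norm_twist hg_norm) (mem_fixedLocus_iff.mp hfix)
  have frame : IsUnitaryFrame W w h g l p (rotatingFrame w h (fun j => s j / l) v) :=
    hv.isUnitaryFrame_rotatingFrame hh hW fun j => by rw [mul_div_cancel₀ _ hl.ne', eigen]
  refine ⟨_, _, frame, ?_, frame.isRotationNumber_rotatingFrame hl.le hh hW hp⟩
  simp only [linearizedFlow_eq, hv.flowMatrix_rotatingFrame hh hW, ← diagonalEnd_apply]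
  exact isRegularPath_diagonalEnd (fun j => div_pos (hs j) hl) hl

end RotatingFrame

theorem sum_defect_twist_add {n : ℕ} {W : MvPolynomial (Fin n) ℂ} {w : Fin n → ℕ} {h : ℕ}
    {g : Fin n → ℂˣ} (hh : 0 < h) (hW : IsWeightedHomogeneous w W h) (hg : g ∈ symmetryGroup W)
    (hg_norm : ∀ i, ‖(g i : ℂ)‖ = 1) (l : ℝ) :
    ∑ i, defect (twist w h g l i) - (Q l - 2 * l) + 2 * (l * (∑ i, thetaJ w h i - 1)) =
      2 * (-(∑ i ∈ indexSet W w h g l, theta g i)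
          + ∑ j ∈ (indexSet W w h g l)ᶜ, (l * thetaJ w h j - l))
        + ∑ i ∈ indexSet W w h g l, Q (l * thetaJ w h i + theta g i)
        + (((indexSet W w h g l)ᶜ.card : ℝ) - 1) * Q l := by
  rw [sum_defect_twist hh hW hg hg_norm,
    ← Finset.sum_add_sum_compl (indexSet W w h g l) (thetaJ w h)]
  simp only [Finset.sum_sub_distrib, Finset.sum_add_distrib, ← Finset.mul_sum, Finset.sum_const,
    nsmul_eq_mul]
  ring

end LGOrbifold

theorem mainTheorem6_general {m : ℕ} (W : MvPolynomial (Fin (m + 1)) ℂ) (w : Fin (m + 1) → ℕ)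
    (h : ℕ) (hw : ∀ i, 0 < w i) (hh : 0 < h) (hW : MvPolynomial.IsWeightedHomogeneous w W h)
    (g : Fin (m + 1) → ℂˣ) (hg : g ∈ LGOrbifold.symmetryGroup W) (hg_norm : ∀ i, ‖(g i : ℂ)‖ = 1)
    (l : ℝ) (hl : 0 < l) (p : Fin (m + 1) → ℂ) (hfix : p ∈ LGOrbifold.fixedLocus w h g l)
    (hp : ∃ i, LGOrbifold.partialAt W i p ≠ 0) (μ : ℝ) :
    LGOrbifold.IsRobbinSalamonIndex W w h g l p μ ↔
      μ = 2 * (-(∑ i ∈ LGOrbifold.indexSet W w h g l, LGOrbifold.theta g i)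
              + ∑ j ∈ (LGOrbifold.indexSet W w h g l)ᶜ, (l * LGOrbifold.thetaJ w h j - l))
          + ∑ i ∈ LGOrbifold.indexSet W w h g l,
              RobbinSalamon.Q (l * LGOrbifold.thetaJ w h i + LGOrbifold.theta g i)
          + (((LGOrbifold.indexSet W w h g l)ᶜ.card : ℝ) - 1) * RobbinSalamon.Q l := by
  rw [← LGOrbifold.sum_defect_twist_add hh hW hg hg_norm l]
  constructor
  · rintro ⟨F, ρ, hF, hreg, hρ, rfl⟩
    exact hF.index_add_rotation hh hW hg hg_norm hl hp hfix hreg hρ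
  · rintro rfl
    obtain ⟨F, ρ, hF, hreg, hρ⟩ :=
      LGOrbifold.exists_isUnitaryFrame hw hh hW hg hg_norm hl hp hfix
    exact ⟨F, ρ, hF, hreg, hρ, (hF.index_add_rotation hh hW hg hg_norm hl hp hfix hreg hρ).symm⟩

theorem mainTheorem6 {m : ℕ} (W : MvPolynomial (Fin (m + 1)) ℂ) (w : Fin (m + 1) → ℕ) (h : ℕ)
    (hW : LGOrbifold.HasWeight W w h) (hnd : LGOrbifold.IsNondegenerate W)
    (g : Fin (m + 1) → ℂˣ) (hg : g ∈ LGOrbifold.symmetryGroup W)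
    (l : ℝ) (hl : 0 < l) (δ : ℝ) (hδ : 0 < δ)
    (p : Fin (m + 1) → ℂ) (hp : p ∈ LGOrbifold.twistedOrbits W w h δ g l) (μ : ℝ) :
    LGOrbifold.IsRobbinSalamonIndex W w h g l p μ ↔
      μ = 2 * (-(∑ i ∈ LGOrbifold.indexSet W w h g l, LGOrbifold.theta g i)
              + ∑ j ∈ (LGOrbifold.indexSet W w h g l)ᶜ, (l * LGOrbifold.thetaJ w h j - l))
          + ∑ i ∈ LGOrbifold.indexSet W w h g l,
              RobbinSalamon.Q (l * LGOrbifold.thetaJ w h i + LGOrbifold.theta g i)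
          + (((LGOrbifold.indexSet W w h g l)ᶜ.card : ℝ) - 1) * RobbinSalamon.Q l :=
  mainTheorem6_general W w h hW.weight_pos hW.degree_pos hW.homogeneous g hg
    (LGOrbifold.norm_eq_one_of_mem_symmetryGroup hnd hg) l hl p hp.1
    (LGOrbifold.exists_partialAt_ne_zero hW.weight_pos hW.homogeneous hnd
      (LGOrbifold.ne_zero_of_mem_link hδ hp.2)) μ
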